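/- Write $[n]=\{1,2,\dots,n\}$; all asymptotic notation is as $n\to\infty$. (1) Fix nonzero integers $a_1,\dots,a_5$ with $a_1+\cdots+a_5=0$. For each $n$ let $X_1,\dots,X_5$ (depending on $n$) be subsets of $[n]$ such that (a) for each $i$, the number of nontrivial solutions $(x_1,x_2,x_3,x_4)\in X_i^4$ to $x_1+x_2=x_3+x_4$ is $o(n)$, where a solution is trivial if $(x_1,x_2)=(x_3,x_4)$ or $(x_1,x_2)=(x_4,x_3)$; and (b) the number of solutions to $a_1x_1+\cdots+a_5x_5=0$ with $x_1\in X_1,\dots,x_5\in X_5$ is $o(n^{3/2})$. Then one can remove $o(\sqrt n)$ elements from each $X_i$ so that no solution to $a_1x_1+\cdots+a_5x_5=0$ with $x_1\in X_1,\dots,x_5\in X_5$ remains. (2) Consequently, fix positive integers $a$ and $b$. Every subset of $[n]$ without a nontrivial solution to $$a x_1+a x_2+b x_3=a x_4+(a+b)x_5$$ has size $o(\sqrt n)$, that is, at most $f(n)$ for some function $f$ with $f(n)=o(\sqrt n)$ depending only on $a$ and $b$. Here a trivial solution is one of the form $(x_1,\dots,x_5)=(x,y,y,x,y)$ or $(y,x,y,x,y)$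 (or $(y,y,x,x,y)$ if $a=b$) with $x,y\in\mathbb Z$. The case $a=1$, $b=2$ is the equation $x_1+x_2+2x_3=x_4+3x_5$. -/

import Mathlib

open Filter Asymptotics

/-- The solutions `x = (x₁, …, x₅)` of `a₁ x₁ + ⋯ + a₅ x₅ = 0` with `xᵢ ∈ Xᵢ` for every `i`. -/
def linSolutions (a : Fin 5 → ℤ) (X : Fin 5 → Finset ℤ) : Finset (Fin 5 → ℤ) :=
  (Fintype.piFinset X).filter fun x => ∑ i, a i * x i = 0

/-- The nontrivial solutions of `x₁ + x₂ = x₃ + x₄` with all variables in `X`: those for which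
`(x₁, x₂)` is neither `(x₃, x₄)` nor `(x₄, x₃)`. -/
def nontrivialQuadruples (X : Finset ℤ) : Finset (Fin 4 → ℤ) :=
  (Fintype.piFinset fun _ => X).filter fun x =>
    x 0 + x 1 = x 2 + x 3 ∧
      ¬ ((x 0 = x 2 ∧ x 1 = x 3) ∨ (x 0 = x 3 ∧ x 1 = x 2))

/-- The trivial solutions of `a x₁ + a x₂ + b x₃ = a x₄ + (a + b) x₅`. -/
def IsTrivialSolution (a b : ℤ) (v : Fin 5 → ℤ) : Prop :=
  ∃ x y : ℤ, v = ![x, y, y, x, y] ∨ v = ![y, x, y, x, y] ∨ (a = b ∧ v = ![y, y, x, x, y])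

/-- `X` contains no nontrivial solution of `a x₁ + a x₂ + b x₃ = a x₄ + (a + b) x₅`. -/
def AvoidsNontrivial (a b : ℤ) (X : Finset ℤ) : Prop :=
  ∀ v : Fin 5 → ℤ, (∀ i, v i ∈ X) →
    a * v 0 + a * v 1 + b * v 2 = a * v 3 + (a + b) * v 4 → IsTrivialSolution a b v

/-! Take a maximal family of solutions no two of which agree in any coordinate, and delete all its
entries. By maximality no solution survives, so it remains to show that the family has $o(\sqrt n)$
members (`card_disjoint_solutions_le`). If it had more than $\delta\sqrt n$, it would force on the
order of $n^{3/2}$ solutions. To see this, work in $\mathbb Z/p$ with $p$ of order $n$ and use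
`many_solutions_of_few_quadruples`, which passes from the sparse problem to a dense one.

Scarcity of additive quadruples bounds the fourth moments of the Fourier transforms, so only
boundedly many characters are large, and these share a set $B$ of almost periods of positive
density. Adding $a_k b$ with $b\in B$ to the $k$-th coordinate keeps solutions solutions because
$\sum a_k=0$. It also spreads every coordinate over the group with few collisions, and after
division by $|B|^5$ it hardly changes the count of solutions with independently chosen variables
(`card_zero_sum_translates_le`).

For spread families the count is bounded below by `many_zero_sums_of_spread`: solutions are
pentagons in a Cayley-type graph, and if there were few, `pentagon_removal` would destroy them all
with few edges, whereas few edges cannot meet all translates of a large spread family.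

For the second statement, a set without nontrivial solutions is a Sidon set, hence has $O(\sqrt n)$
elements and only $O(n)$ solutions. Removal applies, and since constant tuples are solutions, the
removed sets must cover the whole set. -/

namespace SimpleGraph

open Finset SzemerediRegularity

/-! ### Counting pentagons in uniform pairs. -/

section PentagonCounting

variable {α : Type*} {G : SimpleGraph α} [DecidableRel G.Adj] {ε : ℝ} {s t : Finset α}

/-- Large subsets of a dense uniform pair span many edges. -/
lemma IsUniform.mul_card_le_card_interedges (hst : G.IsUniform ε s t)
    (hd : 2 * ε ≤ G.edgeDensity s t) {s' t' : Finset α} (hs : s' ⊆ s) (ht : t' ⊆ t)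
    (hs' : #s * ε ≤ #s') (ht' : #t * ε ≤ #t') :
    ε * #s' * #t' ≤ #(G.interedges s' t') := by
  have h := hst hs ht hs' ht'
  rw [abs_sub_lt_iff] at h
  have hε : ε ≤ G.edgeDensity s' t' := by linarith [h.2]
  rw [edgeDensity_def] at hε
  push_cast at hε
  rcases Nat.eq_zero_or_pos #s' with h0 | h0
  · simp [h0]
  rcases Nat.eq_zero_or_pos #t' with h1 | h1
  · simp [h1]
  rw [le_div_iff₀ (by positivity)] at hε
  linarith

/-- Few vertices of `s` have small degree into a given large subset of `t`, if `(s, t)` is a dense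
uniform pair. -/
lemma IsUniform.card_filter_degree_lt (hst : G.IsUniform ε s t)
    (hd : 2 * ε ≤ G.edgeDensity s t) {t' : Finset α} (ht : t' ⊆ t) (ht' : #t * ε ≤ #t') :
    (#{x ∈ s | (#{y ∈ t' | G.Adj x y} : ℝ) < ε * #t'} : ℝ) ≤ #s * ε := by
  classical
  by_contra! h
  set b := {x ∈ s | (#{y ∈ t' | G.Adj x y} : ℝ) < ε * #t'} with hb
  have h1 := hst.mul_card_le_card_interedges hd (filter_subset _ _ : b ⊆ s) ht h.le ht'
  have h2 : (#(G.interedges b t') : ℝ) = ∑ x ∈ b, (#{y ∈ t' | G.Adj x y} : ℝ) := by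
    have : G.interedges b t' = b.biUnion fun x ↦ {y ∈ t' | G.Adj x y}.image (x, ·) := by
      ext ⟨x, y⟩
      simp [mk_mem_interedges_iff]
    rw [this, card_biUnion]
    · push_cast
      refine sum_congr rfl fun x _ ↦ ?_
      rw [card_image_of_injective _ (Prod.mk_right_injective x)]
    · intro x _ y _ hxy
      rw [Function.onFun, Finset.disjoint_left]
      rintro ⟨u, v⟩ hu hv
      simp only [mem_image, mem_filter, Prod.mk.injEq] at hu hv
      obtain ⟨_, _, rfl, _⟩ := hu
      obtain ⟨_, _, rfl, _⟩ := hv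
      exact hxy rfl
  have hne : b.Nonempty := by
    rw [← card_pos]
    have : (0 : ℝ) < #b := lt_of_le_of_lt (mul_nonneg (by positivity) hst.pos.le) h
    exact_mod_cast this
  have h3 : ∑ x ∈ b, (#{y ∈ t' | G.Adj x y} : ℝ) < ∑ x ∈ b, ε * #t' :=
    sum_lt_sum_of_nonempty hne fun x hx ↦ (mem_filter.1 hx).2
  rw [sum_const, nsmul_eq_mul] at h3
  linarith

variable [Fintype α] [DecidableEq α]

/-- The closed walks of length five in `G`. -/
def closedFiveWalks (G : SimpleGraph α) [DecidableRel G.Adj] : Finset (Fin 5 → α) :=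
  {v | ∀ k, G.Adj (v k) (v (k + 1))}

/-- **Pentagon counting lemma.** -/
lemma pentagon_counting (hε : ε ≤ 1 / 4) (A : Fin 5 → Finset α)
    (hu : ∀ k, G.IsUniform ε (A k) (A (k + 1)))
    (hd : ∀ k, 2 * ε ≤ G.edgeDensity (A k) (A (k + 1))) :
    ε ^ 8 * ∏ k, (#(A k) : ℝ) ≤ #G.closedFiveWalks := by
  have hε0 : 0 < ε := (hu 0).pos
  have hd' : ∀ k, 2 * ε ≤ G.edgeDensity (A (k + 1)) (A k) := fun k ↦ by
    rw [edgeDensity_comm]; exact hd k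
  have h01 : G.IsUniform ε (A 0) (A 1) := hu 0
  have h12 : G.IsUniform ε (A 1) (A 2) := hu 1
  have h23 : G.IsUniform ε (A 2) (A 3) := hu 2
  have h34 : G.IsUniform ε (A 3) (A 4) := hu 3
  have h40 : G.IsUniform ε (A 4) (A 0) := hu 4
  have d01 : 2 * ε ≤ G.edgeDensity (A 0) (A 1) := hd 0
  have d12 : 2 * ε ≤ G.edgeDensity (A 2) (A 1) := hd' 1
  have d23 : 2 * ε ≤ G.edgeDensity (A 2) (A 3) := hd 2
  have d34 : 2 * ε ≤ G.edgeDensity (A 3) (A 4) := hd 3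
  have d40 : 2 * ε ≤ G.edgeDensity (A 0) (A 4) := hd' 4
  have full : ∀ k, (#(A k) : ℝ) * ε ≤ #(A k) := fun k ↦
    mul_le_of_le_one_right (by positivity) (by linarith)
  let N (x : α) (k : Fin 5) : Finset α := {y ∈ A k | G.Adj x y}
  -- A pentagon is built from its vertex `x` in `A 0`: first the opposite edge between `C x` and `D
  -- x`, then the two vertices joining it to `x`. The powers of `ε` lost are 1 for `x`, 3 for the
  -- edge and 2 for each joining vertex, in total 8.
  let good : Finset α := {x ∈ A 0 | ε * #(A 1) ≤ #(N x 1) ∧ ε * #(A 4) ≤ #(N x 4)}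
  let C (x : α) : Finset α := {y ∈ A 2 | ε * #(N x 1) ≤ #{w ∈ N x 1 | G.Adj y w}}
  let D (x : α) : Finset α := {y ∈ A 3 | ε * #(N x 4) ≤ #{w ∈ N x 4 | G.Adj y w}}
  let T := good.sigma fun x ↦ (G.interedges (C x) (D x)).sigma fun p ↦
    {w ∈ N x 1 | G.Adj p.1 w} ×ˢ {w ∈ N x 4 | G.Adj p.2 w}
  have compl_bound : ∀ (s b g : Finset α), s ⊆ b ∪ g → (#b : ℝ) ≤ #s * ε →
      (#s : ℝ) * (1 - ε) ≤ #g := by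
    intro s b g h1 h2
    have : #s ≤ #b + #g := (card_le_card h1).trans (card_union_le _ _)
    have : (#s : ℝ) ≤ #b + #g := by exact_mod_cast this
    linarith
  have hgood : ε * #(A 0) ≤ (#good : ℝ) := by
    have b1 := h01.card_filter_degree_lt d01 (Subset.refl _) (full 1)
    have b4 := h40.symm.card_filter_degree_lt d40 (Subset.refl _) (full 4)
    have hsub : A 0 ⊆ {x ∈ A 0 | (#{y ∈ A 1 | G.Adj x y} : ℝ) < ε * #(A 1)} ∪
        {x ∈ A 0 | (#{y ∈ A 4 | G.Adj x y} : ℝ) < ε * #(A 4)} ∪ good := by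
      intro x hx
      by_cases h1 : (#{y ∈ A 1 | G.Adj x y} : ℝ) < ε * #(A 1)
      · simp [hx, h1]
      by_cases h4 : (#{y ∈ A 4 | G.Adj x y} : ℝ) < ε * #(A 4)
      · simp [hx, h4]
      exact mem_union_right _ (mem_filter.2 ⟨hx, not_lt.1 h1, not_lt.1 h4⟩)
    have := (card_le_card hsub).trans
      ((card_union_le _ _).trans (Nat.add_le_add_right (card_union_le _ _) _))
    have : (#(A 0) : ℝ) ≤ #{x ∈ A 0 | (#{y ∈ A 1 | G.Adj x y} : ℝ) < ε * #(A 1)} +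
      #{x ∈ A 0 | (#{y ∈ A 4 | G.Adj x y} : ℝ) < ε * #(A 4)} + #good := by exact_mod_cast this
    have : (#(A 0) : ℝ) * ε ≤ #(A 0) * (1 / 4) := by gcongr
    have : (0 : ℝ) ≤ #(A 0) := by positivity
    linarith
  have hedges : ∀ x ∈ good, ε ^ 3 * #(A 2) * #(A 3) ≤ (#(G.interedges (C x) (D x)) : ℝ) := by
    intro x hx
    obtain ⟨-, h1, h4⟩ := mem_filter.1 hx
    have c2 := h12.symm.card_filter_degree_lt d12 (filter_subset _ _ : N x 1 ⊆ A 1)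
      (by rwa [mul_comm])
    have c3 := h34.card_filter_degree_lt d34 (filter_subset _ _ : N x 4 ⊆ A 4)
      (by rwa [mul_comm])
    have e2 : (#(A 2) : ℝ) * (1 - ε) ≤ #(C x) := by
      refine compl_bound _ _ _ ?_ c2
      intro y hy
      rw [mem_union, mem_filter, mem_filter]
      by_cases h : (#{w ∈ N x 1 | G.Adj y w} : ℝ) < ε * #(N x 1)
      · exact Or.inl ⟨hy, h⟩
      · exact Or.inr ⟨hy, not_lt.1 h⟩
    have e3 : (#(A 3) : ℝ) * (1 - ε) ≤ #(D x) := by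
      refine compl_bound _ _ _ ?_ c3
      intro y hy
      rw [mem_union, mem_filter, mem_filter]
      by_cases h : (#{w ∈ N x 4 | G.Adj y w} : ℝ) < ε * #(N x 4)
      · exact Or.inl ⟨hy, h⟩
      · exact Or.inr ⟨hy, not_lt.1 h⟩
    have f2 : (#(A 2) : ℝ) * ε ≤ #(C x) := by
      refine le_trans ?_ e2; gcongr; linarith
    have f3 : (#(A 3) : ℝ) * ε ≤ #(D x) := by
      refine le_trans ?_ e3; gcongr; linarith
    have := h23.mul_card_le_card_interedges d23 (filter_subset _ _ : C x ⊆ A 2)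
      (filter_subset _ _ : D x ⊆ A 3) f2 f3
    refine le_trans ?_ this
    calc ε ^ 3 * #(A 2) * #(A 3) = ε * (#(A 2) * ε) * (#(A 3) * ε) := by ring
      _ ≤ _ := by gcongr
  have hT : ε ^ 8 * ∏ k, (#(A k) : ℝ) ≤ #T := by
    have inner : ∀ x ∈ good, ∀ p ∈ G.interedges (C x) (D x),
        ε ^ 4 * #(A 1) * #(A 4) ≤
          (#({w ∈ N x 1 | G.Adj p.1 w} ×ˢ {w ∈ N x 4 | G.Adj p.2 w}) : ℝ) := by
      rintro x hx ⟨c, d⟩ hp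
      obtain ⟨-, h1, h4⟩ := mem_filter.1 hx
      obtain ⟨hc, hd, -⟩ := (mk_mem_interedges_iff _).1 hp
      have h2 := (mem_filter.1 hc).2
      have h3 := (mem_filter.1 hd).2
      rw [card_product]
      push_cast
      calc ε ^ 4 * #(A 1) * #(A 4) = (ε * (ε * #(A 1))) * (ε * (ε * #(A 4))) := by ring
        _ ≤ (ε * #(N x 1)) * (ε * #(N x 4)) := by gcongr
        _ ≤ _ := by gcongr
    rw [card_sigma]
    push_cast
    calc ε ^ 8 * ∏ k, (#(A k) : ℝ)
        = (ε * #(A 0)) * ((ε ^ 3 * #(A 2) * #(A 3)) * (ε ^ 4 * #(A 1) * #(A 4))) := by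
          rw [Fin.prod_univ_five]; ring
      _ ≤ #good * ((ε ^ 3 * #(A 2) * #(A 3)) * (ε ^ 4 * #(A 1) * #(A 4))) := by gcongr
      _ = ∑ x ∈ good, ((ε ^ 3 * #(A 2) * #(A 3)) * (ε ^ 4 * #(A 1) * #(A 4))) := by
          rw [sum_const, nsmul_eq_mul]
      _ ≤ _ := by
          refine sum_le_sum fun x hx ↦ ?_
          rw [card_sigma]
          push_cast
          calc _ ≤ #(G.interedges (C x) (D x)) * (ε ^ 4 * #(A 1) * #(A 4)) := by
                gcongr; exact hedges x hx
            _ = ∑ p ∈ G.interedges (C x) (D x), (ε ^ 4 * #(A 1) * #(A 4)) := by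
                rw [sum_const, nsmul_eq_mul]
            _ ≤ _ := sum_le_sum fun p hp ↦ inner x hx p hp
  refine hT.trans ?_
  norm_cast
  refine card_le_card_of_injOn (fun q ↦ ![q.1, q.2.2.1, q.2.1.1, q.2.1.2, q.2.2.2]) ?_ ?_
  · rintro ⟨x, ⟨c, d⟩, b, e⟩ hq
    simp only [coe_sigma, T] at hq
    obtain ⟨-, hp, hw⟩ := hq
    simp only [mem_coe, mem_product, mem_filter, N] at hw
    have hcd : G.Adj c d := ((mk_mem_interedges_iff _).1 hp).2.2
    simp only [closedFiveWalks, coe_filter, mem_univ, true_and, Set.mem_ofPred_eq]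
    intro k
    fin_cases k
    · exact hw.1.1.2
    · exact hw.1.2.symm
    · exact hcd
    · exact hw.2.2
    · exact hw.2.1.2.symm
  · rintro ⟨x, ⟨c, d⟩, b, e⟩ - ⟨x', ⟨c', d'⟩, b', e'⟩ - h
    have h0 := congrFun h 0
    have h1 := congrFun h 1
    have h2 := congrFun h 2
    have h3 := congrFun h 3
    have h4 := congrFun h 4
    simp at h0 h1 h2 h3 h4
    subst h0 h1 h2 h3 h4
    rfl

end PentagonCounting

/-! ### Pentagon removal from the regularity lemma. -/

section PentagonRemoval

variable {α : Type*} [DecidableEq α] [Fintype α] {G : SimpleGraph α} [DecidableRel G.Adj]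

/-- The factor 2 absorbs the rounding in the average part size, since a quotient that is at least 1
is at most twice its floor. -/
lemma card_div_le_card_of_isEquipartition {P : Finpartition (univ : Finset α)} {M : ℕ}
    {s : Finset α} (hP : P.IsEquipartition) (hM : #P.parts ≤ M) (hs : s ∈ P.parts) :
    (Fintype.card α : ℝ) / (2 * M) ≤ #s := by
  have hpos : 0 < #P.parts := card_pos.2 ⟨s, hs⟩
  have h1 := hP.average_le_card_part hs
  have h2 : #P.parts ≤ Fintype.card α := by simpa using P.card_parts_le_card
  have h3 : Fintype.card α < 2 * #P.parts * (Fintype.card α / #P.parts) := by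
    have h4 := Nat.mod_add_div (Fintype.card α) #P.parts
    have h5 := Nat.mod_lt (Fintype.card α) hpos
    have h6 : 1 ≤ Fintype.card α / #P.parts := (Nat.one_le_div_iff hpos).2 h2
    nlinarith
  rw [card_univ] at h1
  have h7 : Fintype.card α ≤ 2 * M * #s := h3.le.trans (by gcongr)
  have hM0 : (0 : ℝ) < M := by exact_mod_cast hpos.trans_le hM
  rw [div_le_iff₀ (by positivity)]
  have : (Fintype.card α : ℝ) ≤ 2 * M * #s := by exact_mod_cast h7
  linarith

/-- **Pentagon removal lemma.** -/
theorem pentagon_removal {ε : ℝ} (hε : 0 < ε) (hε1 : ε ≤ 1) :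
    ∃ κ : ℝ, 0 < κ ∧ ∀ (α : Type) [Fintype α] [DecidableEq α] [Nonempty α] (G : SimpleGraph α)
      [DecidableRel G.Adj], 4 / ε ≤ Fintype.card α →
      (#G.closedFiveWalks : ℝ) < κ * Fintype.card α ^ 5 →
      ∃ G' ≤ G, (∀ v : Fin 5 → α, ¬ ∀ k, G'.Adj (v k) (v (k + 1))) ∧
        ∀ E : Finset (α × α), (∀ p ∈ E, G.Adj p.1 p.2 ∧ ¬ G'.Adj p.1 p.2) →
          (#E : ℝ) ≤ 2 * ε * Fintype.card α ^ 2 := by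
  set l : ℕ := ⌈4 / ε⌉₊ with hl
  set M : ℕ := bound (ε / 8) l with hM
  have hM0 : 0 < M := bound_pos _ _
  -- One surviving pentagon puts its vertices in parts that are pairwise uniform and dense along the
  -- cycle; counting with `ε / 8` in parts of size at least `card α / (2 * M)` gives this constant.
  refine ⟨(ε / 8) ^ 8 * (1 / (2 * M)) ^ 5, by positivity, ?_⟩
  intro α _ _ _ G _ hcard hG
  obtain ⟨P, hP₁, hP₂, hP₃, hP₄⟩ :=
    szemeredi_regularity G (by positivity : 0 < ε / 8) (Nat.ceil_le.2 hcard)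
  have hP₅ : 4 / ε ≤ #P.parts := (Nat.le_ceil _).trans (by exact_mod_cast hP₂)
  refine ⟨G.regularityReduced P (ε / 8) (ε / 4), regularityReduced_le, ?_, ?_⟩
  · intro v hv
    have key : ∀ k, v k ∈ P.part (v k) ∧ P.part (v k) ∈ P.parts := fun k ↦
      ⟨P.mem_part (mem_univ _), P.part_mem.2 (mem_univ _)⟩
    have hpair : ∀ k, G.IsUniform (ε / 8) (P.part (v k)) (P.part (v (k + 1))) ∧
        ε / 4 ≤ G.edgeDensity (P.part (v k)) (P.part (v (k + 1))) := by
      intro k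
      obtain ⟨-, U, hU, V, hV, hxU, hyV, -, h1, h2⟩ := hv k
      rw [P.part_eq_of_mem hU hxU, P.part_eq_of_mem hV hyV]
      exact ⟨h1, h2⟩
    have := pentagon_counting (by linarith) (fun k ↦ P.part (v k)) (fun k ↦ (hpair k).1)
      (fun k ↦ by linarith [(hpair k).2])
    refine absurd hG (not_lt.2 (le_trans ?_ this))
    have hb : ((Fintype.card α : ℝ) / (2 * M)) ^ 5 ≤ ∏ k : Fin 5, (#(P.part (v k)) : ℝ) := by
      have := prod_le_prod (s := (univ : Finset (Fin 5)))
        (f := fun _ ↦ (Fintype.card α : ℝ) / (2 * M)) (g := fun k ↦ (#(P.part (v k)) : ℝ))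
        (fun _ _ ↦ by positivity)
        (fun k _ ↦ card_div_le_card_of_isEquipartition hP₁ hP₃ (key k).2)
      rwa [prod_const, card_univ, Fintype.card_fin] at this
    calc _ = (ε / 8) ^ 8 * ((Fintype.card α : ℝ) / (2 * M)) ^ 5 := by ring
      _ ≤ _ := by gcongr
  · intro E hE
    have h := regularityReduced_edges_card_aux hε hP₁ hP₄ hP₅
    -- Ordered pairs count each deleted edge twice.
    have e : ((#{p : α × α | G.Adj p.1 p.2 ∧
        ¬ (G.regularityReduced P (ε / 8) (ε / 4)).Adj p.1 p.2} : ℕ) : ℝ) =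
        2 * (#G.edgeFinset - #(G.regularityReduced P (ε / 8) (ε / 4)).edgeFinset : ℝ) := by
      rw [mul_sub, filter_and_not, cast_card_sdiff]
      · norm_cast
        rw [two_mul_card_edgeFinset, two_mul_card_edgeFinset]
      · gcongr with xy _
        exact fun hxy ↦ regularityReduced_le hxy
    push_cast at h
    rw [← e] at h
    refine le_trans ?_ h.le
    exact_mod_cast card_le_card fun p hp ↦ mem_filter.2 ⟨mem_univ _, hE p hp⟩

end PentagonRemoval

end SimpleGraph

/-! ### Zero-sum tuples as pentagons. -/

section DenseCounting

open Finset

variable {G : Type} [AddCommGroup G]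

/-- The Cayley-type graph on five copies of `G` whose pentagons encode the solutions of
`y₀ + ⋯ + y₄ = 0` with `yₖ ∈ Y k`. -/
def pentagonGraph (Y : Fin 5 → Finset G) : SimpleGraph (Fin 5 × G) where
  Adj x y := (y.1 = x.1 + 1 ∧ y.2 - x.2 ∈ Y x.1) ∨ (x.1 = y.1 + 1 ∧ x.2 - y.2 ∈ Y y.1)
  symm := ⟨fun _ _ h ↦ h.symm⟩
  loopless := ⟨fun x h ↦ by
    have : ∀ k : Fin 5, k ≠ k + 1 := by decide
    rcases h with h | h <;> exact this _ h.1⟩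

instance [DecidableEq G] (Y : Fin 5 → Finset G) : DecidableRel (pentagonGraph Y).Adj :=
  fun x y ↦ inferInstanceAs <| Decidable <|
    (y.1 = x.1 + 1 ∧ y.2 - x.2 ∈ Y x.1) ∨ (x.1 = y.1 + 1 ∧ x.2 - y.2 ∈ Y y.1)

/-- A sum of five signs is odd and at most 5 in absolute value, so it vanishes modulo 5 only if all
signs agree. -/
lemma closed_walk_in_five_cycle (c : Fin 5 → Fin 5)
    (h : ∀ k, c (k + 1) = c k + 1 ∨ c k = c (k + 1) + 1) :
    (∀ k, c k = c 0 + k) ∨ ∀ k, c (-k) = c 0 + k := by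
  have key : ∀ c₀ c₁ : Fin 5, (c₁ = c₀ + 1 ∨ c₀ = c₁ + 1) → ∀ c₂, (c₂ = c₁ + 1 ∨ c₁ = c₂ + 1) →
      ∀ c₃, (c₃ = c₂ + 1 ∨ c₂ = c₃ + 1) → ∀ c₄, (c₄ = c₃ + 1 ∨ c₃ = c₄ + 1) →
      (c₀ = c₄ + 1 ∨ c₄ = c₀ + 1) →
      (c₁ = c₀ + 1 ∧ c₂ = c₀ + 2 ∧ c₃ = c₀ + 3 ∧ c₄ = c₀ + 4) ∨
      (c₁ = c₀ + 4 ∧ c₂ = c₀ + 3 ∧ c₃ = c₀ + 2 ∧ c₄ = c₀ + 1) := by decide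
  rcases key _ _ (h 0) _ (h 1) _ (h 2) _ (h 3) (h 4) with ⟨h1, h2, h3, h4⟩ | ⟨h1, h2, h3, h4⟩
  · left
    intro k
    fin_cases k
    exacts [(add_zero _).symm, h1, h2, h3, h4]
  · right
    intro k
    fin_cases k
    exacts [(add_zero _).symm, h4, h3, h2, h1]

variable [Fintype G] [DecidableEq G]

/-- The solutions of `y₀ + ⋯ + y₄ = 0` with `yₖ ∈ Y k`. -/
def zeroSumTuples (Y : Fin 5 → Finset G) : Finset (Fin 5 → G) :=
  {y | (∀ k, y k ∈ Y k) ∧ ∑ k, y k = 0}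

/-- A closed walk goes once round the five layers, so it is fixed by its direction (2), its starting
vertex (`5 * card G`) and its steps, which form a zero-sum tuple. -/
lemma card_closedFiveWalks_pentagonGraph_le (Y : Fin 5 → Finset G) :
    #(pentagonGraph Y).closedFiveWalks ≤ 10 * Fintype.card G * #(zeroSumTuples Y) := by
  set F : Finset (Fin 5 → Fin 5 × G) :=
    {v ∈ (pentagonGraph Y).closedFiveWalks | ∀ k, (v k).1 = (v 0).1 + k} with hF
  have hsub : (pentagonGraph Y).closedFiveWalks ⊆ F ∪ F.image (fun v k ↦ v (-k)) := by
    intro v hv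
    have hv' := (mem_filter.1 hv).2
    rcases closed_walk_in_five_cycle (fun k ↦ (v k).1)
      (fun k ↦ (hv' k).imp And.left And.left) with h | h
    · exact mem_union_left _ (mem_filter.2 ⟨hv, h⟩)
    · refine mem_union_right _ (mem_image.2 ⟨fun k ↦ v (-k), ?_, ?_⟩)
      · refine mem_filter.2 ⟨mem_filter.2 ⟨mem_univ _, fun k ↦ ?_⟩, ?_⟩
        · have := (hv' (-(k + 1))).symm
          rwa [show -(k + 1) + 1 = -k by abel] at this
        · simpa using h
      · simp
  have hFcard : #F ≤ 5 * Fintype.card G * #(zeroSumTuples Y) := by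
    have : 5 * Fintype.card G * #(zeroSumTuples Y) =
        #((univ : Finset (Fin 5 × G)) ×ˢ zeroSumTuples Y) := by
      rw [card_product, card_univ, Fintype.card_prod, Fintype.card_fin]
    rw [this]
    refine card_le_card_of_injOn
      -- The walk leaves layer `i` at time `i - (v 0).1`, so steps are indexed by layer rather than
      -- by time.
      (fun v ↦ (v 0, fun i ↦ (v (i - (v 0).1 + 1)).2 - (v (i - (v 0).1)).2)) ?_ ?_
    · intro v hv
      obtain ⟨hv, hc⟩ := mem_filter.1 (mem_coe.1 hv)
      have hadj := (mem_filter.1 hv).2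
      refine mem_coe.2 (mem_product.2 ⟨mem_univ _, mem_filter.2 ⟨mem_univ _, fun i ↦ ?_, ?_⟩⟩)
      · have hne : ∀ a b : Fin 5, a + b ≠ a + (b + 1) + 1 := by decide
        have h := hadj (i - (v 0).1)
        rcases h with h | h
        · have h2 := h.2
          rw [hc (i - (v 0).1)] at h2
          simpa using h2
        · exact absurd h.1 (by rw [hc (i - (v 0).1), hc (i - (v 0).1 + 1)]; exact hne _ _)
      · rw [sum_sub_distrib, sub_eq_zero]
        refine Fintype.sum_equiv (Equiv.addRight 1) _ _ fun i ↦ ?_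
        simp only [Equiv.coe_addRight]
        congr 2
        abel
    · intro v hv v' hv' h
      have hc := (mem_filter.1 (mem_coe.1 hv)).2
      have hc' := (mem_filter.1 (mem_coe.1 hv')).2
      simp only [Prod.mk.injEq] at h
      obtain ⟨h0, h⟩ := h
      have hstep : ∀ k, (v (k + 1)).2 - (v k).2 = (v' (k + 1)).2 - (v' k).2 := by
        intro k
        have := congrFun h (k + (v 0).1)
        rw [← h0] at this
        simpa using this
      have hnext : ∀ k, v k = v' k → v (k + 1) = v' (k + 1) := by
        intro k hk
        refine Prod.ext ?_ ?_
        · rw [hc, hc', h0]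
        · have := hstep k
          rwa [hk, sub_left_inj] at this
      have h1 : v 1 = v' 1 := hnext 0 h0
      have h2 : v 2 = v' 2 := hnext 1 h1
      have h3 : v 3 = v' 3 := hnext 2 h2
      have h4 : v 4 = v' 4 := hnext 3 h3
      funext k
      fin_cases k
      exacts [h0, h1, h2, h3, h4]
  have hcard := (card_le_card hsub).trans (card_union_le _ _)
  have himage : #(F.image fun v k ↦ v (-k)) ≤ #F := card_image_le
  linarith

variable {I : Type} [Fintype I]

/-- Each zero-sum tuple of popular values lifts to at least `r ^ 5` index tuples, and different
tuples have disjoint lifts. -/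
lemma card_zeroSumTuples_mul_pow_le (W : Fin 5 → I → G) (Y : Fin 5 → Finset G) {r : ℝ}
    (hr : 0 ≤ r) (hY : ∀ k, ∀ y ∈ Y k, r ≤ #{q | W k q = y}) :
    #(zeroSumTuples Y) * r ^ 5 ≤ #{t : Fin 5 → I | ∑ k, W k (t k) = 0} := by
  have h1 : ∀ y ∈ zeroSumTuples Y,
      r ^ 5 ≤ #{t ∈ ({t : Fin 5 → I | ∑ k, W k (t k) = 0} : Finset _) |
        (fun k ↦ W k (t k)) = y} := by
    intro y hy
    obtain ⟨hy1, hy2⟩ := (mem_filter.1 hy).2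
    have : Fintype.piFinset (fun k ↦ ({q | W k q = y k} : Finset I)) ⊆
        {t ∈ ({t : Fin 5 → I | ∑ k, W k (t k) = 0} : Finset _) | (fun k ↦ W k (t k)) = y} := by
      intro t ht
      have ht' : ∀ k, W k (t k) = y k := by simpa using ht
      simp [ht', hy2]
    refine le_trans ?_ (Nat.cast_le.2 (card_le_card this))
    rw [Fintype.card_piFinset]
    push_cast
    have := prod_le_prod (s := (univ : Finset (Fin 5)))
      (f := fun _ ↦ r) (g := fun k ↦ (#{q | W k q = y k} : ℝ)) (fun _ _ ↦ hr)
      (fun k _ ↦ hY k _ (hy1 k))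
    rwa [prod_const, card_univ, Fintype.card_fin] at this
  calc #(zeroSumTuples Y) * r ^ 5 = ∑ y ∈ zeroSumTuples Y, r ^ 5 := by
        rw [sum_const, nsmul_eq_mul]
    _ ≤ ∑ y ∈ zeroSumTuples Y, (#{t ∈ ({t : Fin 5 → I | ∑ k, W k (t k) = 0} : Finset _) |
        (fun k ↦ W k (t k)) = y} : ℝ) := sum_le_sum h1
    _ ≤ _ := by
      rw [← Nat.cast_sum, Nat.cast_le]
      rw [sum_card_fiberwise_eq_card_filter]
      exact card_le_card (filter_subset _ _)

lemma sum_sq_card_fiber {G I : Type} [Fintype G] [DecidableEq G] [Fintype I] (W : I → G) :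
    ∑ y, #{q | W q = y} ^ 2 = #{p : I × I | W p.1 = W p.2} := by
  rw [card_eq_sum_card_fiberwise (t := univ) (f := fun p ↦ W p.1) (fun _ _ ↦ mem_coe.2 (mem_univ _))]
  refine sum_congr rfl fun y _ ↦ ?_
  rw [sq, ← card_product]
  congr 1
  ext ⟨p, q⟩
  simp only [mem_product, mem_filter, mem_univ, true_and]
  constructor
  · rintro ⟨rfl, h⟩; exact ⟨h.symm, rfl⟩
  · rintro ⟨h, rfl⟩; exact ⟨rfl, h.symm⟩

/-- If `W` has few collisions then few translates of the pairs `(P q, P q + W q)` lie in a small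
set of pairs. -/
lemma card_translates_mem_sq_le (P W : I → G) (E : Finset (G × G)) :
    #{p : I × G | (p.2 + P p.1, p.2 + P p.1 + W p.1) ∈ E} ^ 2 ≤
      #E * (Fintype.card G * #{p : I × I | W p.1 = W p.2}) := by
  have h1 : #{p : I × G | (p.2 + P p.1, p.2 + P p.1 + W p.1) ∈ E} ≤
      ∑ e ∈ E, #{q | W q = e.2 - e.1} := by
    -- For a given pair `e` and index `q`, the translation `u` is determined.
    rw [card_eq_sum_card_fiberwise (t := E)
      (f := fun p ↦ (p.2 + P p.1, p.2 + P p.1 + W p.1)) (fun p hp ↦ by simpa using hp)]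
    refine sum_le_sum fun e _ ↦ card_le_card_of_injOn Prod.fst ?_ ?_
    · rintro ⟨q, u⟩ h
      obtain ⟨-, rfl⟩ := mem_filter.1 (mem_coe.1 h)
      simp
    · rintro ⟨q, u⟩ h ⟨q', u'⟩ h' hq
      obtain ⟨-, rfl⟩ := mem_filter.1 (mem_coe.1 h)
      have h2 := (mem_filter.1 (mem_coe.1 h')).2
      simp only at hq
      subst hq
      simpa [eq_comm] using (Prod.ext_iff.1 h2).1
  have h2 : ∑ e ∈ E, #{q | W q = e.2 - e.1} ^ 2 ≤
      Fintype.card G * #{p : I × I | W p.1 = W p.2} := by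
    calc _ ≤ ∑ e : G × G, #{q | W q = e.2 - e.1} ^ 2 :=
          sum_le_sum_of_subset (subset_univ _)
      _ = ∑ _x : G, ∑ y : G, #{q | W q = y} ^ 2 := by
          rw [Fintype.sum_prod_type]
          exact sum_congr rfl fun x _ ↦ Fintype.sum_equiv (Equiv.subRight x) _ _ fun y ↦ rfl
      _ = _ := by
          rw [sum_sq_card_fiber, sum_const, card_univ, smul_eq_mul]
  calc _ ≤ (∑ e ∈ E, #{q | W q = e.2 - e.1}) ^ 2 := by gcongr
    _ ≤ #E * ∑ e ∈ E, #{q | W q = e.2 - e.1} ^ 2 := sq_sum_le_card_mul_sum_sq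
    _ ≤ _ := by gcongr

end DenseCounting

/-! ### Many zero sums from a spread family. -/

section DenseTheorem

open Finset

/-- A large family of solutions of `y₀ + ⋯ + y₄ = 0` in which each variable is well spread forces
many solutions when the variables are chosen independently. -/
theorem many_zero_sums_of_spread {δ : ℝ} (hδ : 0 < δ) :
    ∃ θ : ℝ, 0 < θ ∧ ∃ N₀ : ℝ, ∀ (G : Type) [AddCommGroup G] [Fintype G] [DecidableEq G],
      N₀ ≤ Fintype.card G → ∀ (I : Type) [Fintype I] [DecidableEq I] (W : Fin 5 → I → G) (β : ℝ),
      0 < β → (∀ q, ∑ k, W k q = 0) →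
      (∀ k, (#{p : I × I | W k p.1 = W k p.2} : ℝ) ≤ 3 * β ^ 2) →
      δ * √(Fintype.card G) * β ≤ Fintype.card I →
      θ * (Fintype.card G * √(Fintype.card G)) * β ^ 5 ≤
        #{t : Fin 5 → I | ∑ k, W k (t k) = 0} := by
  -- Chosen so that `50 * γ * 3 ≤ (δ / 20) ^ 2`, where `50 * γ * N ^ 2` bounds the deleted edges on
  -- `5 * N` vertices.
  set γ : ℝ := min 1 (δ ^ 2 / 60000) with hγ
  have hγ0 : 0 < γ := by positivity
  obtain ⟨κ, hκ, removal⟩ := SimpleGraph.pentagon_removal hγ0 (min_le_left _ _)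
  refine ⟨κ * (δ / 20) ^ 5, by positivity, 4 / γ, ?_⟩
  intro G _ _ _ hN I _ _ W β hβ hW hcoll hI
  set N : ℝ := ((Fintype.card G : ℕ) : ℝ) with hNdef
  have hN0 : 0 < N := by rw [hNdef]; exact_mod_cast Fintype.card_pos
  set R : ℝ := √N with hR
  have hR0 : 0 < R := Real.sqrt_pos.2 hN0
  have hRN : R * R = N := Real.mul_self_sqrt hN0.le
  by_contra! hlt
  set r : ℝ := δ / 20 * β / R with hr
  have hr0 : 0 < r := by positivity
  -- Only popular values are kept as edges: the others account for at most `N * r` indices, a small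
  -- part of the family.
  let Y : Fin 5 → Finset G := fun k ↦ {y | r ≤ #{q | W k q = y}}
  have hcount := card_zeroSumTuples_mul_pow_le W Y hr0.le (fun k y hy ↦ (mem_filter.1 hy).2)
  have hsol : (#(zeroSumTuples Y) : ℝ) < κ * N ^ 4 := by
    have h1 : #(zeroSumTuples Y) * r ^ 5 < κ * N ^ 4 * r ^ 5 := by
      refine hcount.trans_lt (hlt.trans_eq ?_)
      rw [hr, ← hRN]
      field_simp
    exact lt_of_mul_lt_mul_right h1 (by positivity)
  have hwalks : (#(pentagonGraph Y).closedFiveWalks : ℝ) <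
      κ * (Fintype.card (Fin 5 × G) : ℕ) ^ 5 := by
    have h1 : (#(pentagonGraph Y).closedFiveWalks : ℝ) ≤ 10 * N * #(zeroSumTuples Y) := by
      rw [hNdef]
      exact_mod_cast card_closedFiveWalks_pentagonGraph_le Y
    rw [Fintype.card_prod, Fintype.card_fin]
    push_cast
    rw [← hNdef]
    calc _ ≤ 10 * N * #(zeroSumTuples Y) := h1
      _ < 10 * N * (κ * N ^ 4) := by gcongr
      _ = 10 * (κ * N ^ 5) := by ring
      _ ≤ 3125 * (κ * N ^ 5) := by gcongr; norm_num
      _ = _ := by ring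
  obtain ⟨G', hG', hfree, hfew⟩ := removal (Fin 5 × G) (pentagonGraph Y) (by
    rw [Fintype.card_prod, Fintype.card_fin]
    push_cast
    linarith) hwalks
  classical
  -- Partial sums of the solution `q`: every translate by `u` is a closed walk, the last step
  -- closing up because the sum is zero.
  let P : Fin 5 → I → G := fun k q ↦
    ![0, W 0 q, W 0 q + W 1 q, W 0 q + W 1 q + W 2 q, W 0 q + W 1 q + W 2 q + W 3 q] k
  have hP : ∀ k q, P (k + 1) q = P k q + W k q := by
    intro k q
    have hz := hW q
    rw [Fin.sum_univ_five] at hz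
    fin_cases k
    · exact (zero_add _).symm
    · rfl
    · rfl
    · rfl
    · exact hz.symm
  let E : Fin 5 → Finset (G × G) := fun k ↦
    {e | (pentagonGraph Y).Adj (k, e.1) (k + 1, e.2) ∧ ¬ G'.Adj (k, e.1) (k + 1, e.2)}
  have hE : ∀ k, (#(E k) : ℝ) ≤ 50 * γ * N ^ 2 := by
    intro k
    have h1 := hfew ((E k).image fun e ↦ ((k, e.1), (k + 1, e.2))) (by
      intro p hp
      obtain ⟨e, he, rfl⟩ := mem_image.1 hp
      exact (mem_filter.1 he).2)
    rw [card_image_of_injective _ (by rintro ⟨a, b⟩ ⟨c, d⟩ h; simpa using h), Fintype.card_prod,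
      Fintype.card_fin] at h1
    push_cast at h1
    rw [← hNdef] at h1
    linarith
  let B₁ : Fin 5 → Finset (I × G) := fun k ↦ ({q | W k q ∉ Y k} : Finset I) ×ˢ univ
  let B₂ : Fin 5 → Finset (I × G) := fun k ↦
    {p | (p.2 + P k p.1, p.2 + P k p.1 + W k p.1) ∈ E k}
  -- As `G'` has no pentagon, each translate uses an unpopular step or a deleted edge. These ten bad
  -- sets each have at most a `δ / 20` share, too little to cover everything.
  have hcover : (univ : Finset (I × G)) ⊆ univ.biUnion fun k ↦ B₁ k ∪ B₂ k := by
    rintro ⟨q, u⟩ -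
    obtain ⟨k, hk⟩ := not_forall.1 (hfree fun k ↦ (k, u + P k q))
    refine mem_biUnion.2 ⟨k, mem_univ _, mem_union.2 ?_⟩
    by_cases h : W k q ∈ Y k
    · right
      refine mem_filter.2 ⟨mem_univ _, mem_filter.2 ⟨mem_univ _, Or.inl ⟨rfl, ?_⟩, ?_⟩⟩
      · simpa using h
      · rw [hP, ← add_assoc] at hk
        exact hk
    · left
      simp [B₁, h]
  have hB₁ : ∀ k, (#(B₁ k) : ℝ) ≤ δ / 20 * β * R * N := by
    intro k
    have h1 : (#{q | W k q ∉ Y k} : ℝ) ≤ N * r := by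
      rw [card_eq_sum_card_fiberwise (t := (Y k)ᶜ) (f := W k) (fun q hq ↦ by simpa using hq)]
      push_cast
      calc _ ≤ ∑ y ∈ (Y k)ᶜ, r := by
            refine sum_le_sum fun y hy ↦ ?_
            have hy' : (#{q | W k q = y} : ℝ) < r := by simpa [Y] using hy
            refine le_trans ?_ hy'.le
            exact_mod_cast card_le_card (filter_subset_filter _ (subset_univ _))
        _ = #((Y k)ᶜ) * r := by rw [sum_const, nsmul_eq_mul]
        _ ≤ N * r := by gcongr; rw [hNdef]; exact_mod_cast card_le_univ _
    rw [card_product, card_univ]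
    push_cast
    rw [← hNdef]
    refine mul_le_mul_of_nonneg_right (h1.trans_eq ?_) hN0.le
    rw [hr, ← hRN]
    field_simp
  have hB₂ : ∀ k, (#(B₂ k) : ℝ) ≤ δ / 20 * β * R * N := by
    intro k
    have h1 : (#(B₂ k) : ℝ) ^ 2 ≤ #(E k) * (N * #{p : I × I | W k p.1 = W k p.2}) := by
      rw [hNdef]
      exact_mod_cast card_translates_mem_sq_le (P k) (W k) (E k)
    refine abs_le_of_sq_le_sq' ?_ (by positivity) |>.2
    calc _ ≤ 50 * γ * N ^ 2 * (N * (3 * β ^ 2)) := by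
          refine h1.trans ?_
          gcongr
          · exact hE k
          · exact hcoll k
      _ ≤ 50 * (δ ^ 2 / 60000) * N ^ 2 * (N * (3 * β ^ 2)) := by
          gcongr; exact min_le_right _ _
      _ = _ := by rw [← hRN]; ring
  have htotal : (Fintype.card I : ℝ) * N ≤ δ / 2 * β * R * N := by
    have h1 : #(univ : Finset (I × G)) ≤ ∑ k, (#(B₁ k) + #(B₂ k)) :=
      (card_le_card hcover).trans (card_biUnion_le.trans (sum_le_sum fun k _ ↦ card_union_le _ _))
    rw [card_univ, Fintype.card_prod] at h1
    have h2 : (Fintype.card I : ℝ) * N ≤ ∑ k, ((#(B₁ k) : ℝ) + #(B₂ k)) := by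
      rw [hNdef]; exact_mod_cast h1
    refine h2.trans ((sum_le_sum fun k _ ↦ add_le_add (hB₁ k) (hB₂ k)).trans_eq ?_)
    rw [sum_const, card_univ, Fintype.card_fin, nsmul_eq_mul]
    push_cast
    ring
  have h1 : (Fintype.card I : ℝ) ≤ δ / 2 * β * R := le_of_mul_le_mul_right htotal hN0
  have h2 : 0 < δ * R * β := by positivity
  linarith

end DenseTheorem

/-! ### Fourier transforms and additive quadruples. -/

section CharacterSums

open Finset

variable {G : Type} [AddCommGroup G] [Fintype G] [DecidableEq G] {α : Type} [Fintype α]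

/-- The Fourier transform at `ψ` of the multiset of values of `w`. -/
noncomputable def charSum (w : α → G) (ψ : AddChar G ℂ) : ℂ := ∑ a, ψ (w a)

lemma norm_charSum_le {G α : Type} [AddCommGroup G] [Finite G] [Fintype α] (w : α → G) (ψ : AddChar G ℂ) :
    ‖charSum w ψ‖ ≤ Fintype.card α := by
  refine (norm_sum_le _ _).trans ?_
  simp [ψ.norm_apply]

/-- Orthogonality of characters. -/
lemma card_zero_sum_mul_card {n : ℕ} (w : Fin n → α → G) :
    (#{t : Fin n → α | ∑ i, w i (t i) = 0} : ℂ) * Fintype.card G =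
      ∑ ψ : AddChar G ℂ, ∏ i, charSum (w i) ψ := by
  classical
  have hprod : ∀ (ψ : AddChar G ℂ) (t : Fin n → α), ∏ i, ψ (w i (t i)) = ψ (∑ i, w i (t i)) :=
    fun ψ t ↦ (map_prod ψ.toMonoidHom (fun i ↦ Multiplicative.ofAdd (w i (t i))) univ).symm
  simp_rw [charSum, prod_univ_sum, Fintype.piFinset_univ, hprod]
  rw [sum_comm]
  simp_rw [AddChar.sum_apply_eq_ite]
  rw [← sum_filter, sum_const, nsmul_eq_mul]

lemma sum_norm_charSum_pow_four (w : α → G) :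
    ∑ ψ : AddChar G ℂ, ‖charSum w ψ‖ ^ 4 =
      Fintype.card G * #{t : Fin 4 → α | w (t 0) + w (t 1) = w (t 2) + w (t 3)} := by
  have h := card_zero_sum_mul_card ![w, w, -w, -w]
  have hneg : ∀ ψ : AddChar G ℂ, charSum (-w) ψ = starRingEnd ℂ (charSum w ψ) := by
    intro ψ
    simp [charSum, AddChar.map_neg_eq_conj]
  have h4 : ∀ ψ : AddChar G ℂ, ∏ i, charSum (![w, w, -w, -w] i) ψ =
      ((‖charSum w ψ‖ ^ 4 : ℝ) : ℂ) := by
    intro ψ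
    rw [Fin.prod_univ_four]
    change charSum w ψ * charSum w ψ * charSum (-w) ψ * charSum (-w) ψ = _
    rw [hneg]
    have := Complex.mul_conj' (charSum w ψ)
    push_cast
    linear_combination (charSum w ψ * starRingEnd ℂ (charSum w ψ) + ‖charSum w ψ‖ ^ 2) * this
  simp_rw [h4] at h
  have hset : #{t : Fin 4 → α | ∑ i, ![w, w, -w, -w] i (t i) = 0} =
      #{t : Fin 4 → α | w (t 0) + w (t 1) = w (t 2) + w (t 3)} := by
    congr 1
    ext t
    simp only [mem_filter, mem_univ, true_and, Fin.sum_univ_four]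
    change w (t 0) + w (t 1) + -w (t 2) + -w (t 3) = 0 ↔ _
    rw [add_assoc, ← neg_add, ← sub_eq_add_neg, sub_eq_zero]
  rw [hset] at h
  rw [mul_comm]
  exact_mod_cast h.symm

/-- The index quadruples giving nontrivial solutions of `x₀ + x₁ = x₂ + x₃` among the values of
`w`. -/
def nontrivialIndexQuadruples {G α : Type} [AddCommGroup G] [DecidableEq G] [Fintype α]
    [DecidableEq α] (w : α → G) : Finset (Fin 4 → α) :=
  {t | w (t 0) + w (t 1) = w (t 2) + w (t 3) ∧
    ¬ ((t 0 = t 2 ∧ t 1 = t 3) ∨ (t 0 = t 3 ∧ t 1 = t 2))}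

lemma card_additive_quadruples_le {G α : Type} [AddCommGroup G] [DecidableEq G] [Fintype α]
    [DecidableEq α] (w : α → G) :
    #{t : Fin 4 → α | w (t 0) + w (t 1) = w (t 2) + w (t 3)} ≤
      2 * Fintype.card α ^ 2 + #(nontrivialIndexQuadruples w) := by
  have hsub : ({t : Fin 4 → α | w (t 0) + w (t 1) = w (t 2) + w (t 3)} : Finset _) ⊆
      (univ : Finset (α × α)).image (fun p ↦ ![p.1, p.2, p.1, p.2]) ∪
      (univ : Finset (α × α)).image (fun p ↦ ![p.1, p.2, p.2, p.1]) ∪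
      nontrivialIndexQuadruples w := by
    intro t ht
    by_cases h1 : t 0 = t 2 ∧ t 1 = t 3
    · refine mem_union_left _ (mem_union_left _ (mem_image.2 ⟨(t 0, t 1), mem_univ _, ?_⟩))
      funext k
      fin_cases k
      exacts [rfl, rfl, h1.1, h1.2]
    by_cases h2 : t 0 = t 3 ∧ t 1 = t 2
    · refine mem_union_left _ (mem_union_right _ (mem_image.2 ⟨(t 0, t 1), mem_univ _, ?_⟩))
      funext k
      fin_cases k
      exacts [rfl, rfl, h2.2, h2.1]
    · exact mem_union_right _
        (mem_filter.2 ⟨mem_univ _, (mem_filter.1 ht).2, not_or.2 ⟨h1, h2⟩⟩)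
  have hcard : #(univ : Finset (α × α)) = Fintype.card α ^ 2 := by
    rw [card_univ, Fintype.card_prod, sq]
  refine (card_le_card hsub).trans ((card_union_le _ _).trans ?_)
  have h1 := card_union_le ((univ : Finset (α × α)).image (fun p ↦ ![p.1, p.2, p.1, p.2]))
    ((univ : Finset (α × α)).image (fun p ↦ ![p.1, p.2, p.2, p.1]))
  have h2 := card_image_le (s := (univ : Finset (α × α))) (f := fun p ↦ ![p.1, p.2, p.1, p.2])
  have h3 := card_image_le (s := (univ : Finset (α × α))) (f := fun p ↦ ![p.1, p.2, p.2, p.1])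
  omega

/-- Fix one representation of `d` as a difference; every further one combines with it into a
nontrivial quadruple. -/
lemma card_offDiag_sub_eq_le {G α : Type} [AddCommGroup G] [DecidableEq G] [Fintype α]
    [DecidableEq α] (w : α → G) (d : G) :
    #{p : α × α | p.1 ≠ p.2 ∧ w p.1 - w p.2 = d} ≤
      1 + #{t ∈ nontrivialIndexQuadruples w | w (t 0) - w (t 3) = d} := by
  rcases ({p : α × α | p.1 ≠ p.2 ∧ w p.1 - w p.2 = d} : Finset _).eq_empty_or_nonempty
    with h | ⟨⟨a, a'⟩, ha⟩
  · simp [h]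
  have ha' := (mem_filter.1 ha).2
  simp only at ha'
  rw [← card_erase_add_one ha, add_comm]
  refine Nat.add_le_add_left (card_le_card_of_injOn (fun p ↦ ![p.1, a', a, p.2]) ?_ ?_) 1
  · rintro ⟨b, b'⟩ hb
    obtain ⟨hne, hb⟩ := mem_erase.1 (mem_coe.1 hb)
    have hb' := (mem_filter.1 hb).2
    simp only at hb'
    have e : w b + w a' = w a + w b' := by
      have h1 := hb'.2
      rw [← ha'.2] at h1
      rw [← sub_eq_zero] at h1 ⊢
      rw [← h1]
      abel
    refine mem_coe.2 (mem_filter.2 ⟨mem_filter.2 ⟨mem_univ _, e, ?_⟩, hb'.2⟩)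
    rintro (⟨h1, h2⟩ | ⟨h1, -⟩)
    · change b = a at h1
      change a' = b' at h2
      exact hne (by rw [h1, h2])
    · exact hb'.1 h1
  · rintro ⟨b, b'⟩ - ⟨c, c'⟩ - h
    have h0 : b = c := congrFun h 0
    have h3 : b' = c' := congrFun h 3
    rw [h0, h3]

/-- The collisions among the translates `w a + u b` when `w` has few additive quadruples. -/
lemma card_collisions_le {G α β : Type} [AddCommGroup G] [DecidableEq G] [Fintype α]
    [DecidableEq α] [Fintype β] [DecidableEq β] (w : α → G) (u : β → G)
    (hu : Function.Injective u) :
    #{p : (α × β) × (α × β) | w p.1.1 + u p.1.2 = w p.2.1 + u p.2.2} ≤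
      Fintype.card α * Fintype.card β + Fintype.card β ^ 2 +
        Fintype.card β * #(nontrivialIndexQuadruples w) := by
  -- Off-diagonal collisions are sorted by `c`. For fixed `c.1` the differences `u c.2 - u c.1` are
  -- distinct, so each nontrivial quadruple is charged at most once.
  let D : β × β → Finset (α × α) := fun c ↦ {p | p.1 ≠ p.2 ∧ w p.1 - w p.2 = u c.2 - u c.1}
  have hsub : ({p : (α × β) × (α × β) | w p.1.1 + u p.1.2 = w p.2.1 + u p.2.2} : Finset _) ⊆
      (univ : Finset (α × β)).image (fun q ↦ (q, q)) ∪
      (univ : Finset (β × β)).biUnion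
        fun c ↦ (D c).image fun p ↦ ((p.1, c.1), (p.2, c.2)) := by
    rintro ⟨⟨a, b⟩, ⟨a', b'⟩⟩ hp
    have hp' : w a + u b = w a' + u b' := (mem_filter.1 hp).2
    by_cases h : a = a'
    · subst h
      have := hu (add_left_cancel hp')
      subst this
      exact mem_union_left _ (mem_image.2 ⟨(a, b), mem_univ _, rfl⟩)
    · refine mem_union_right _ (mem_biUnion.2 ⟨(b, b'), mem_univ _, mem_image.2
        ⟨(a, a'), mem_filter.2 ⟨mem_univ _, h, ?_⟩, rfl⟩⟩)
      rw [← sub_eq_zero] at hp' ⊢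
      rw [← hp']
      simp only
      abel
  have h1 : #((univ : Finset (α × β)).image (fun q ↦ (q, q))) ≤
      Fintype.card α * Fintype.card β :=
    card_image_le.trans (by rw [card_univ, Fintype.card_prod])
  have h2 : ∑ c, #(D c) ≤ Fintype.card β ^ 2 + Fintype.card β * #(nontrivialIndexQuadruples w) := by
    calc _ ≤ ∑ c : β × β,
          (1 + #{t ∈ nontrivialIndexQuadruples w | w (t 0) - w (t 3) = u c.2 - u c.1}) :=
          sum_le_sum fun c _ ↦ card_offDiag_sub_eq_le w _
      _ = Fintype.card β ^ 2 + ∑ b : β, ∑ b' : β,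
          #{t ∈ nontrivialIndexQuadruples w | w (t 0) - w (t 3) = u b' - u b} := by
          rw [sum_add_distrib, Fintype.sum_prod_type
            (f := fun c : β × β ↦
              #{t ∈ nontrivialIndexQuadruples w | w (t 0) - w (t 3) = u c.2 - u c.1})]
          simp [sq]
      _ ≤ Fintype.card β ^ 2 + ∑ _b : β, #(nontrivialIndexQuadruples w) := by
          gcongr with b
          rw [← card_biUnion]
          · exact card_le_card (biUnion_subset.2 fun _ _ ↦ filter_subset _ _)
          · intro b₁ _ b₂ _ hne
            rw [Function.onFun, disjoint_left]
            intro t h1 h2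
            have e1 := (mem_filter.1 h1).2
            have e2 := (mem_filter.1 h2).2
            exact hne (hu (sub_left_injective (e1.symm.trans e2)))
      _ = _ := by rw [sum_const, card_univ, smul_eq_mul]
  calc _ ≤ _ := (card_le_card hsub).trans (card_union_le _ _)
    _ ≤ Fintype.card α * Fintype.card β + ∑ c, #(D c) :=
      add_le_add h1 (card_biUnion_le.trans (sum_le_sum fun _ _ ↦ card_image_le))
    _ ≤ _ := by omega

end CharacterSums

/-! ### Common almost periods by pigeonhole. -/

section AlmostPeriods

open Finset

/-- A bounded number of characters of `G` have a common set of almost periods of positive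
density. -/
lemma exists_almost_periods {η : ℝ} (hη : 0 < η) (L : ℕ) :
    ∃ c : ℝ, 0 < c ∧ ∀ (G : Type) [AddCommGroup G] [Fintype G] [DecidableEq G]
      (T : Finset (AddChar G ℂ)), #T ≤ L →
      ∃ B : Finset G, c * Fintype.card G ≤ #B ∧ ∀ ψ ∈ T, ∀ b ∈ B, ‖ψ b - 1‖ ≤ η := by
  classical
  obtain ⟨t, -, htfin, hcov⟩ :=
    finite_cover_balls_of_compact (isCompact_closedBall (0 : ℂ) 1) (half_pos hη)
  lift t to Finset ℂ using htfin
  have hcenter : ∀ z : ℂ, ‖z‖ ≤ 1 → ∃ y ∈ t, dist z y < η / 2 := by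
    intro z hz
    have := hcov (mem_closedBall_zero_iff.2 hz)
    simpa using this
  choose! center hmem hdist using hcenter
  have ht : 0 < #t := card_pos.2 ⟨_, hmem 0 (by simp)⟩
  have ht' : (1 : ℝ) ≤ #t := by exact_mod_cast ht
  refine ⟨1 / (#t : ℝ) ^ L, by positivity, ?_⟩
  intro G _ _ _ T hT
  have hnorm : ∀ (ψ : AddChar G ℂ) (g : G), ‖ψ g‖ = 1 := fun ψ g ↦ ψ.norm_apply g
  -- Rounding all character values to a finite net leaves boundedly many patterns; differences
  -- within a most popular pattern are almost periods.
  let f : G → (T → ℂ) := fun g ψ ↦ center (ψ.1 g)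
  have hcard : (#(Fintype.piFinset fun _ : T ↦ t) : ℝ) ≤ (#t : ℝ) ^ L := by
    rw [Fintype.card_piFinset, prod_const, card_univ, Fintype.card_coe]
    push_cast
    exact pow_le_pow_right₀ ht' hT
  obtain ⟨y, -, hy⟩ := exists_le_card_fiber_of_nsmul_le_card_of_maps_to
    (s := (univ : Finset G)) (t := Fintype.piFinset fun _ : T ↦ t) (f := f)
    (b := 1 / (#t : ℝ) ^ L * Fintype.card G)
    (fun g _ ↦ Fintype.mem_piFinset.2 fun ψ ↦ hmem _ (hnorm _ _).le)
    ⟨f 0, Fintype.mem_piFinset.2 fun ψ ↦ hmem _ (hnorm _ _).le⟩ (by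
      rw [nsmul_eq_mul, card_univ, ← mul_assoc, mul_one_div]
      exact mul_le_of_le_one_left (by positivity) (div_le_one_of_le₀ hcard (by positivity)))
  have hne : ({g | f g = y} : Finset G).Nonempty := by
    rw [← card_pos]
    have : (0 : ℝ) < #{g | f g = y} := lt_of_lt_of_le (by positivity) hy
    exact_mod_cast this
  obtain ⟨g₀, hg₀⟩ := hne
  refine ⟨({g | f g = y} : Finset G).image (· - g₀), ?_, ?_⟩
  · rwa [card_image_of_injective _ sub_left_injective]
  · intro ψ hψ b hb
    obtain ⟨g, hg, rfl⟩ := mem_image.1 hb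
    have h1 : f g ⟨ψ, hψ⟩ = f g₀ ⟨ψ, hψ⟩ := by
      rw [(mem_filter.1 hg).2, (mem_filter.1 hg₀).2]
    have h2 : center (ψ g) = center (ψ g₀) := h1
    have h3 : ψ (g - g₀) * ψ g₀ = ψ g := by
      rw [← AddChar.map_add_eq_mul, sub_add_cancel]
    calc ‖ψ (g - g₀) - 1‖ = ‖(ψ (g - g₀) - 1) * ψ g₀‖ := by rw [norm_mul, hnorm, mul_one]
      _ = dist (ψ g) (ψ g₀) := by rw [sub_mul, h3, one_mul, dist_eq_norm]
      _ ≤ dist (ψ g) (center (ψ g)) + dist (ψ g₀) (center (ψ g₀)) := by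
        rw [h2]; exact dist_triangle_right _ _ _
      _ ≤ η := by linarith [hdist _ (hnorm ψ g).le, hdist _ (hnorm ψ g₀).le]

end AlmostPeriods

/-! ### Perturbing products of five factors. -/

section Transference

open Finset

lemma norm_prod_sub_one_le_sum {ι : Type*} (s : Finset ι) (m : ι → ℂ) (hm : ∀ i ∈ s, ‖m i‖ ≤ 1) :
    ‖∏ i ∈ s, m i - 1‖ ≤ ∑ i ∈ s, ‖m i - 1‖ := by
  classical
  induction s using Finset.induction_on with
  | empty => simp
  | insert a s ha ih =>
    rw [prod_insert ha, sum_insert ha]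
    have h1 := ih fun i hi ↦ hm i (mem_insert_of_mem hi)
    have h2 := hm a (mem_insert_self a s)
    calc ‖m a * ∏ i ∈ s, m i - 1‖ = ‖(m a - 1) + m a * (∏ i ∈ s, m i - 1)‖ := by ring_nf
      _ ≤ ‖m a - 1‖ + ‖m a‖ * ‖∏ i ∈ s, m i - 1‖ := (norm_add_le _ _).trans (by rw [norm_mul])
      _ ≤ ‖m a - 1‖ + 1 * ‖∏ i ∈ s, m i - 1‖ := by gcongr
      _ ≤ _ := by rw [one_mul]; gcongr

lemma mul_mul_mul_le_sum_pow_four (a b c d : ℝ) :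
    a * b * c * d ≤ (a ^ 4 + b ^ 4 + c ^ 4 + d ^ 4) / 4 := by
  nlinarith [sq_nonneg (a * b - c * d), sq_nonneg (a ^ 2 - b ^ 2), sq_nonneg (c ^ 2 - d ^ 2)]

lemma norm_prod_mul_sub_prod_le (F m : Fin 5 → ℂ) {D : ℝ} (hD : 0 ≤ D) (hm : ∀ i, ‖m i‖ ≤ 1)
    (h : ∀ i, ‖F i‖ * ‖m i - 1‖ ≤ D) :
    ‖∏ i, (F i * m i) - ∏ i, F i‖ ≤ D * ∑ i, ‖F i‖ ^ 4 := by
  have h1 : ‖∏ i, (F i * m i) - ∏ i, F i‖ ≤ (∏ i, ‖F i‖) * ∑ i, ‖m i - 1‖ := by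
    rw [prod_mul_distrib, ← mul_sub_one, norm_mul, norm_prod]
    gcongr
    exact norm_prod_sub_one_le_sum _ _ fun i _ ↦ hm i
  refine h1.trans ?_
  -- One factor is spent with its perturbation on `D`; the other four are bounded by their fourth
  -- powers, each of which occurs four times with weight 1/4.
  have amgm : ∀ x e a b c d : ℝ, x * e ≤ D → 0 ≤ a * b * c * d →
      x * e * (a * b * c * d) ≤ D * ((a ^ 4 + b ^ 4 + c ^ 4 + d ^ 4) / 4) := fun x e a b c d h1 h2 ↦
    (mul_le_mul_of_nonneg_right h1 h2).trans
      (mul_le_mul_of_nonneg_left (mul_mul_mul_le_sum_pow_four a b c d) hD)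
  rw [Fin.prod_univ_five, Fin.sum_univ_five, Fin.sum_univ_five]
  have e0 := amgm _ _ ‖F 1‖ ‖F 2‖ ‖F 3‖ ‖F 4‖ (h 0) (by positivity)
  have e1 := amgm _ _ ‖F 0‖ ‖F 2‖ ‖F 3‖ ‖F 4‖ (h 1) (by positivity)
  have e2 := amgm _ _ ‖F 0‖ ‖F 1‖ ‖F 3‖ ‖F 4‖ (h 2) (by positivity)
  have e3 := amgm _ _ ‖F 0‖ ‖F 1‖ ‖F 2‖ ‖F 4‖ (h 3) (by positivity)
  have e4 := amgm _ _ ‖F 0‖ ‖F 1‖ ‖F 2‖ ‖F 3‖ (h 4) (by positivity)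
  linarith

end Transference

/-! ### Large spectrum and the effect of translation. -/

section SparseCounting

open Finset

variable {G : Type} [AddCommGroup G] [Fintype G] [DecidableEq G] {J : Type} [Fintype J]
  [DecidableEq J]

/-- The trivial character alone contributes `card J ^ 4` to the fourth moment, which forces `card J
= O(√card G)`; this in turn bounds the whole moment. -/
lemma card_sq_and_fourth_moment_le (w : J → G)
    (hw : (#(nontrivialIndexQuadruples w) : ℝ) ≤ Fintype.card G) :
    (Fintype.card J : ℝ) ^ 2 ≤ 3 * Fintype.card G ∧
      ∑ ψ : AddChar G ℂ, ‖charSum w ψ‖ ^ 4 ≤ 7 * (Fintype.card G : ℝ) ^ 2 := by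
  set N : ℝ := ((Fintype.card G : ℕ) : ℝ) with hN
  have hN0 : 0 < N := by rw [hN]; exact_mod_cast Fintype.card_pos
  set m : ℝ := ((Fintype.card J : ℕ) : ℝ) with hm
  have hm0 : 0 ≤ m := by rw [hm]; positivity
  have h1 : (#{t : Fin 4 → J | w (t 0) + w (t 1) = w (t 2) + w (t 3)} : ℝ) ≤ 2 * m ^ 2 + N := by
    have : (#{t : Fin 4 → J | w (t 0) + w (t 1) = w (t 2) + w (t 3)} : ℝ) ≤
        2 * m ^ 2 + #(nontrivialIndexQuadruples w) := by
      rw [hm]; exact_mod_cast card_additive_quadruples_le w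
    linarith
  have h2 : ∑ ψ : AddChar G ℂ, ‖charSum w ψ‖ ^ 4 ≤ N * (2 * m ^ 2 + N) := by
    rw [sum_norm_charSum_pow_four]
    gcongr
  have h3 : m ^ 4 ≤ N * (2 * m ^ 2 + N) := by
    refine le_trans ?_ h2
    have h0 : ‖charSum w (0 : AddChar G ℂ)‖ = m := by
      simp [charSum, hm]
    rw [← h0]
    exact single_le_sum (f := fun ψ : AddChar G ℂ ↦ ‖charSum w ψ‖ ^ 4)
      (fun _ _ ↦ by positivity) (mem_univ _)
  have h4 : m ^ 2 ≤ 3 * N := by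
    by_contra! h
    nlinarith
  exact ⟨h4, h2.trans (by nlinarith)⟩

lemma card_large_spectrum_le {G J : Type} [AddCommGroup G] [Fintype G] [Fintype J] (w : J → G) {ε : ℝ} (hε : 0 < ε)
    (hw : ∑ ψ : AddChar G ℂ, ‖charSum w ψ‖ ^ 4 ≤ 7 * (Fintype.card G : ℝ) ^ 2) :
    (#{ψ : AddChar G ℂ | ε * √(Fintype.card G) < ‖charSum w ψ‖} : ℝ) ≤ 7 / ε ^ 4 := by
  have hN0 : (0 : ℝ) < Fintype.card G := by exact_mod_cast Fintype.card_pos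
  set R : ℝ := √(Fintype.card G) with hR
  have hRN : R * R = Fintype.card G := Real.mul_self_sqrt hN0.le
  have hR0 : 0 < R := Real.sqrt_pos.2 hN0
  rw [le_div_iff₀ (by positivity)]
  have h1 : (#{ψ : AddChar G ℂ | ε * R < ‖charSum w ψ‖} : ℝ) * (ε * R) ^ 4 ≤
      7 * (Fintype.card G : ℝ) ^ 2 := by
    refine le_trans ?_ hw
    rw [← nsmul_eq_mul, ← sum_const]
    refine (sum_le_sum fun ψ hψ ↦ ?_).trans
      (sum_le_sum_of_subset_of_nonneg (subset_univ _) fun _ _ _ ↦ by positivity)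
    have := (mem_filter.1 hψ).2
    gcongr
  rw [← hRN] at h1
  have h2 : (0 : ℝ) < R ^ 4 := by positivity
  refine le_of_mul_le_mul_right ?_ h2
  linarith

/-- Translating each variable by a set of common almost periods hardly changes the number of
solutions. -/
lemma card_zero_sum_translates_le {J : Type} [Fintype J] (w : Fin 5 → J → G) (s : Fin 5 → G →+ G) (B : Finset G)
    (hB : B.Nonempty) {D : ℝ} (hD : 0 ≤ D)
    (hw : ∀ k, ∑ ψ : AddChar G ℂ, ‖charSum (w k) ψ‖ ^ 4 ≤ 7 * (Fintype.card G : ℝ) ^ 2)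
    (hperiod : ∀ k, ∀ ψ : AddChar G ℂ, ∃ ρ, ‖charSum (w k) ψ‖ * ρ ≤ D ∧
      ∀ b ∈ B, ‖ψ (s k b) - 1‖ ≤ ρ) :
    (#{t : Fin 5 → J × B | ∑ k, (w k (t k).1 + s k (t k).2) = 0} : ℝ) ≤
      (#B : ℝ) ^ 5 * (#{t : Fin 5 → J | ∑ k, w k (t k) = 0} + 35 * D * Fintype.card G) := by
  set N : ℝ := ((Fintype.card G : ℕ) : ℝ) with hN
  have hN0 : 0 < N := by rw [hN]; exact_mod_cast Fintype.card_pos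
  have hβ : (0 : ℝ) < #B := by exact_mod_cast hB.card_pos
  have hβ' : (#B : ℂ) ≠ 0 := by exact_mod_cast hβ.ne'
  let u : Fin 5 → B → G := fun k b ↦ s k b
  -- Translating by `s k B` multiplies the transform by `#B * m k ψ`, and `m k ψ` is near 1 wherever
  -- the transform is large.
  let m : Fin 5 → AddChar G ℂ → ℂ := fun k ψ ↦ charSum (u k) ψ / #B
  have hm1 : ∀ k ψ, ‖m k ψ‖ ≤ 1 := by
    intro k ψ
    have := norm_charSum_le (u k) ψ
    rw [Fintype.card_coe] at this
    rw [norm_div, Complex.norm_natCast]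
    exact div_le_one_of_le₀ this hβ.le
  have hm2 : ∀ k ψ, ‖charSum (w k) ψ‖ * ‖m k ψ - 1‖ ≤ D := by
    intro k ψ
    obtain ⟨ρ, h1, h2⟩ := hperiod k ψ
    refine le_trans (mul_le_mul_of_nonneg_left ?_ (norm_nonneg _)) h1
    have h3 : m k ψ - 1 = (∑ b : B, (ψ (u k b) - 1)) / #B := by
      rw [sum_sub_distrib, sum_const, card_univ, Fintype.card_coe, nsmul_eq_mul, mul_one, sub_div,
        div_self hβ']
      rfl
    rw [h3, norm_div, Complex.norm_natCast, div_le_iff₀ hβ]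
    calc _ ≤ ∑ b : B, ‖ψ (u k b) - 1‖ := norm_sum_le _ _
      _ ≤ ∑ _b : B, ρ := sum_le_sum fun b _ ↦ h2 b b.2
      _ = ρ * #B := by rw [sum_const, card_univ, Fintype.card_coe, nsmul_eq_mul, mul_comm]
  have e1 := card_zero_sum_mul_card (G := G) fun k (q : J × B) ↦ w k q.1 + s k q.2
  have e2 := card_zero_sum_mul_card w
  have hfactor : ∀ k ψ, charSum (fun q : J × B ↦ w k q.1 + s k q.2) ψ =
      #B * (charSum (w k) ψ * m k ψ) := by
    intro k ψ
    have : charSum (fun q : J × B ↦ w k q.1 + s k q.2) ψ =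
        charSum (w k) ψ * charSum (u k) ψ := by
      simp only [charSum, AddChar.map_add_eq_mul, Fintype.sum_prod_type, sum_mul_sum, u]
    rw [this]
    simp only [m]
    field_simp
  have hdiff : (#{t : Fin 5 → J × B | ∑ k, (w k (t k).1 + s k (t k).2) = 0} : ℂ) * Fintype.card G -
      (#B : ℂ) ^ 5 * (#{t : Fin 5 → J | ∑ k, w k (t k) = 0} * Fintype.card G) =
      (#B : ℂ) ^ 5 * ∑ ψ : AddChar G ℂ,
        (∏ k, (charSum (w k) ψ * m k ψ) - ∏ k, charSum (w k) ψ) := by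
    rw [e1, e2, sum_sub_distrib, mul_sub]
    congr 1
    rw [mul_sum]
    refine sum_congr rfl fun ψ _ ↦ ?_
    simp_rw [hfactor]
    rw [prod_mul_distrib, prod_const, card_univ, Fintype.card_fin]
  have hbound : ‖∑ ψ : AddChar G ℂ,
      (∏ k, (charSum (w k) ψ * m k ψ) - ∏ k, charSum (w k) ψ)‖ ≤ 35 * D * N ^ 2 := by
    calc _ ≤ ∑ ψ : AddChar G ℂ, D * ∑ k, ‖charSum (w k) ψ‖ ^ 4 :=
          norm_sum_le_of_le _ fun ψ _ ↦ norm_prod_mul_sub_prod_le (fun k ↦ charSum (w k) ψ)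
            (fun k ↦ m k ψ) hD (fun k ↦ hm1 k ψ) fun k ↦ hm2 k ψ
      _ = D * ∑ k, ∑ ψ : AddChar G ℂ, ‖charSum (w k) ψ‖ ^ 4 := by rw [← mul_sum, sum_comm]
      _ ≤ D * ∑ _k : Fin 5, 7 * N ^ 2 := by gcongr with k; exact hw k
      _ = 35 * D * N ^ 2 := by
          rw [sum_const, card_univ, Fintype.card_fin, nsmul_eq_mul]; push_cast; ring
  have hreal : (#{t : Fin 5 → J × B | ∑ k, (w k (t k).1 + s k (t k).2) = 0} : ℝ) * N -
      (#B : ℝ) ^ 5 * (#{t : Fin 5 → J | ∑ k, w k (t k) = 0} * N) ≤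
      (#B : ℝ) ^ 5 * (35 * D * N ^ 2) := by
    refine (le_abs_self _).trans ?_
    rw [← Real.norm_eq_abs, ← Complex.norm_real]
    push_cast
    rw [hN, Complex.ofReal_natCast, hdiff, norm_mul, norm_pow, Complex.norm_natCast]
    gcongr
  refine le_of_mul_le_mul_right ?_ hN0
  linarith

end SparseCounting

/-! ### From the dense count to the sparse one. -/

section SparseTheorem

open Finset

/-- If the values of each `w k` span few nontrivial additive quadruples, then many disjoint
solutions of `x₀ + ⋯ + x₄ = 0` force many solutions. -/
theorem many_solutions_of_few_quadruples {δ : ℝ} (hδ : 0 < δ) :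
    ∃ c : ℝ, 0 < c ∧ ∃ N₀ : ℝ, ∀ (G : Type) [AddCommGroup G] [Fintype G] [DecidableEq G],
      N₀ ≤ Fintype.card G → ∀ (s : Fin 5 → G →+ G), (∀ k, Function.Injective (s k)) →
      (∀ b, ∑ k, s k b = 0) → ∀ (J : Type) [Fintype J] [DecidableEq J] (w : Fin 5 → J → G),
      (∀ j, ∑ k, w k j = 0) →
      (∀ k, (#(nontrivialIndexQuadruples (w k)) : ℝ) ≤ c * Fintype.card G) →
      δ * √(Fintype.card G) ≤ Fintype.card J →
      c * (Fintype.card G * √(Fintype.card G)) ≤ #{t : Fin 5 → J | ∑ k, w k (t k) = 0} := by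
  obtain ⟨θ, hθ, N₁, dense⟩ := many_zero_sums_of_spread hδ
  -- With `D = 2 * ε * R` the transference error `35 * D * N` is half of the dense lower bound.
  set ε : ℝ := θ / 140 with hε
  have hε0 : 0 < ε := by positivity
  obtain ⟨cB, hcB, periods⟩ := exists_almost_periods hε0 ⌊5 * (7 / ε ^ 4)⌋₊
  set c : ℝ := min (θ / 2) (min cB 1) with hc
  have hcθ : c ≤ θ / 2 := min_le_left _ _
  have hccB : c ≤ cB := (min_le_right _ _).trans (min_le_left _ _)
  have hc1 : c ≤ 1 := (min_le_right _ _).trans (min_le_right _ _)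
  refine ⟨c, by positivity, max N₁ (4 / cB ^ 2), ?_⟩
  intro G _ _ _ hG s hs hs0 J _ _ w hsol hquad hJ
  set N : ℝ := ((Fintype.card G : ℕ) : ℝ) with hN
  have hN0 : 0 < N := by rw [hN]; exact_mod_cast Fintype.card_pos
  set R : ℝ := √N with hR
  have hR0 : 0 < R := Real.sqrt_pos.2 hN0
  have hRN : R * R = N := Real.mul_self_sqrt hN0.le
  have hmoment := fun k ↦ card_sq_and_fourth_moment_le (w k)
    ((hquad k).trans (mul_le_of_le_one_left hN0.le hc1))
  have hm : (Fintype.card J : ℝ) ≤ 2 * R :=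
    abs_le_of_sq_le_sq' (by rw [mul_pow, sq R, hRN]; linarith [(hmoment 0).1])
      (by positivity) |>.2
  classical
  let S : Fin 5 → Finset (AddChar G ℂ) := fun k ↦ {ψ | ε * R < ‖charSum (w k) ψ‖}
  -- The large characters are pulled back along `s k`, so that one set `B` serves all five
  -- coordinates.
  let T : Finset (AddChar G ℂ) :=
    univ.biUnion fun k ↦ (S k).image fun ψ ↦ ψ.compAddMonoidHom (s k)
  have hT : #T ≤ ⌊5 * (7 / ε ^ 4)⌋₊ := by
    refine Nat.le_floor ?_
    have h1 : #T ≤ ∑ k, #(S k) := card_biUnion_le.trans (sum_le_sum fun _ _ ↦ card_image_le)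
    calc (#T : ℝ) ≤ ∑ k, (#(S k) : ℝ) := by exact_mod_cast h1
      _ ≤ ∑ _k : Fin 5, 7 / ε ^ 4 :=
        sum_le_sum fun k _ ↦ card_large_spectrum_le (w k) hε0 (hmoment k).2
      _ = _ := by rw [sum_const, card_univ, Fintype.card_fin, nsmul_eq_mul]; push_cast; rfl
  obtain ⟨B, hBcard, hB⟩ := periods G T hT
  rw [← hN] at hBcard
  have hβ : (0 : ℝ) < #B := lt_of_lt_of_le (by positivity) hBcard
  have hBne : B.Nonempty := card_pos.1 (by exact_mod_cast hβ)
  have hmB : (Fintype.card J : ℝ) ≤ #B := by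
    refine hm.trans (le_trans ?_ hBcard)
    have h1 : 4 / cB ^ 2 ≤ N := (le_max_right _ _).trans hG
    have h2 : 2 / cB ≤ R := by
      rw [hR]
      refine Real.le_sqrt_of_sq_le ?_
      rw [div_pow]
      norm_num
      exact h1
    rw [div_le_iff₀ hcB] at h2
    rw [← hRN]
    nlinarith
  have hupper := card_zero_sum_translates_le w s B hBne (D := 2 * ε * R) (by positivity)
    (fun k ↦ (hmoment k).2) (by
      intro k ψ
      -- Both cases cost `2 * ε * R`: a large transform (at most `2 * R`) has deviation `ε`, a small
      -- one (at most `ε * R`) has deviation at most 2.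
      by_cases hψ : ψ ∈ S k
      · refine ⟨ε, ?_, fun b hb ↦ ?_⟩
        · calc _ ≤ 2 * R * ε := by
                gcongr; exact (norm_charSum_le (w k) ψ).trans hm
            _ = _ := by ring
        · exact hB _ (mem_biUnion.2 ⟨k, mem_univ _, mem_image_of_mem _ hψ⟩) b hb
      · refine ⟨2, ?_, fun b _ ↦ ?_⟩
        · have : ‖charSum (w k) ψ‖ ≤ ε * R := by simpa [S] using hψ
          linarith
        · refine (norm_sub_le _ _).trans ?_
          rw [ψ.norm_apply, norm_one]
          norm_num)
  have hlower := dense G ((le_max_left _ _).trans hG) (J × B)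
    (fun k q ↦ w k q.1 + s k q.2) #B hβ
    (fun q ↦ by rw [sum_add_distrib, hsol, hs0, add_zero])
    (fun k ↦ by
      have h1 := card_collisions_le (w k) (fun b : B ↦ s k b)
        ((hs k).comp Subtype.val_injective)
      rw [Fintype.card_coe] at h1
      have h2 : (#{p : (J × B) × (J × B) |
          w k p.1.1 + s k p.1.2 = w k p.2.1 + s k p.2.2} : ℝ) ≤
          Fintype.card J * #B + (#B : ℝ) ^ 2 + #B * #(nontrivialIndexQuadruples (w k)) := by
        exact_mod_cast h1
      have h3 : (#(nontrivialIndexQuadruples (w k)) : ℝ) ≤ #B :=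
        (hquad k).trans ((mul_le_mul_of_nonneg_right hccB hN0.le).trans hBcard)
      refine h2.trans ?_
      nlinarith)
    (by
      rw [Fintype.card_prod, Fintype.card_coe]
      push_cast
      exact mul_le_mul_of_nonneg_right hJ hβ.le)
  have hβ5 : (0 : ℝ) < (#B : ℝ) ^ 5 := by positivity
  have hfinal := hlower.trans hupper
  rw [mul_comm] at hfinal
  have h1 := le_of_mul_le_mul_left hfinal hβ5
  rw [← hN, ← hR] at h1
  have h2 : c * (N * R) ≤ θ / 2 * (N * R) := by gcongr
  have h3 : 35 * (2 * ε * R) * N = θ / 2 * (N * R) := by rw [hε]; ring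
  linarith

end SparseTheorem

/-! ### Removal in the integers. -/

section IntegerRemoval

open Finset

/-- A family of tuples is coordinatewise disjoint if no coordinate takes
the same value on two different members. -/
def CoordinatewiseDisjoint (J : Finset (Fin 5 → ℤ)) : Prop :=
  ∀ x ∈ J, ∀ y ∈ J, ∀ i, x i = y i → x = y

lemma exists_maximal_disjoint_family (S : Finset (Fin 5 → ℤ)) :
    ∃ J ⊆ S, CoordinatewiseDisjoint J ∧ ∀ v ∈ S, ∃ x ∈ J, ∃ i, v i = x i := by
  classical
  obtain ⟨J, hJ, hmax⟩ := exists_max_image {J ∈ S.powerset | CoordinatewiseDisjoint J} card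
    ⟨∅, mem_filter.2 ⟨empty_mem_powerset _, fun x hx ↦ by simp at hx⟩⟩
  obtain ⟨hJS, hdisj⟩ := mem_filter.1 hJ
  rw [mem_powerset] at hJS
  refine ⟨J, hJS, hdisj, fun v hv ↦ ?_⟩
  by_contra! h
  have hvJ : v ∉ J := fun hvJ ↦ h v hvJ 0 rfl
  have hins : insert v J ∈ ({J ∈ S.powerset | CoordinatewiseDisjoint J} : Finset _) := by
    refine mem_filter.2 ⟨mem_powerset.2 (insert_subset hv hJS), ?_⟩
    intro x hx y hy i hxy
    rcases mem_insert.1 hx with hxv | hx <;> rcases mem_insert.1 hy with hyv | hy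
    · rw [hxv, hyv]
    · exact absurd (hxv ▸ hxy) (h y hy i)
    · exact absurd (hyv ▸ hxy.symm) (h x hx i)
    · exact hdisj x hx y hy i hxy
  have := hmax _ hins
  rw [card_insert_of_notMem hvJ] at this
  omega

lemma int_eq_zero_of_cast_zmod_eq_zero {p : ℕ} {z : ℤ} (h : (z : ZMod p) = 0) (hz : |z| < p) :
    z = 0 :=
  Int.eq_zero_of_abs_lt_dvd ((ZMod.intCast_zmod_eq_zero_iff_dvd z p).1 h) hz

/-- Few additive quadruples and few solutions leave room only for few disjoint solutions. -/
theorem card_disjoint_solutions_le {a : Fin 5 → ℤ} (ha : ∀ i, a i ≠ 0) (hsum : ∑ i, a i = 0)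
    {δ : ℝ} (hδ : 0 < δ) :
    ∃ c : ℝ, 0 < c ∧ ∃ n₀ : ℕ, ∀ n ≥ n₀, ∀ X : Fin 5 → Finset ℤ, (∀ i, X i ⊆ Icc 1 (n : ℤ)) →
      (∀ i, (#(nontrivialQuadruples (X i)) : ℝ) ≤ c * n) →
      (#(linSolutions a X) : ℝ) < c * (n * √n) →
      ∀ J ⊆ linSolutions a X, CoordinatewiseDisjoint J → (#J : ℝ) ≤ δ * √n := by
  set A : ℕ := ∑ i, (a i).natAbs with hA
  -- A prime above `(A + 2) * n` is too large for wrap-around, both in the linear equation (size at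
  -- most `A * n`) and in the additive quadruples (size below `2 * n`).
  set K : ℕ := A + 2 with hK
  obtain ⟨c, hc, N₀, main⟩ := many_solutions_of_few_quadruples
    -- The prime is at most `2 * K * n`, so `δ / √(2 * K) * √p ≤ δ * √n`.
    (show 0 < δ / √(2 * K) by have : 0 < K := by omega
                              positivity)
  refine ⟨c, hc, max 1 ⌈N₀⌉₊, ?_⟩
  intro n hn X hX hquad hlin J hJ hdisj
  have hn1 : 1 ≤ n := (le_max_left _ _).trans hn
  have hnN : N₀ ≤ n := Nat.ceil_le.1 ((le_max_right _ _).trans hn)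
  obtain ⟨p, hp, hp1, hp2⟩ := Nat.exists_prime_lt_and_le_two_mul (K * n)
    (Nat.mul_ne_zero (by omega) (by omega))
  have : Fact p.Prime := ⟨hp⟩
  have hAn : A * n + 2 * n < p := by
    have : K * n = A * n + 2 * n := by rw [hK]; ring
    omega
  have hnp : n ≤ p := by nlinarith
  have hle : ∀ i, (a i).natAbs ≤ A := fun i ↦
    single_le_sum (f := fun i ↦ (a i).natAbs) (fun _ _ ↦ Nat.zero_le _) (mem_univ i)
  have hap : ∀ i, (a i : ZMod p) ≠ 0 := by
    intro i h
    refine ha i (int_eq_zero_of_cast_zmod_eq_zero h ?_)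
    rw [Int.abs_eq_natAbs]
    have := hle i
    exact_mod_cast (show (a i).natAbs < p by nlinarith)
  have hmem : ∀ x ∈ J, ∀ i, x i ∈ X i := fun x hx ↦
    Fintype.mem_piFinset.1 (mem_filter.1 (hJ hx)).1
  have hrange : ∀ x ∈ J, ∀ i, 1 ≤ x i ∧ x i ≤ n := fun x hx i ↦
    mem_Icc.1 (hX i (hmem x hx i))
  by_contra! hlt
  have hcardZ : Fintype.card (ZMod p) = p := ZMod.card p
  let w : Fin 5 → J → ZMod p := fun k x ↦ ((a k * x.1 k : ℤ) : ZMod p)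
  have hmany := main (ZMod p) (by rw [hcardZ]; exact hnN.trans (by exact_mod_cast hnp))
    (fun k ↦ AddMonoidHom.mulLeft (a k : ZMod p))
    (fun k x y h ↦ mul_left_cancel₀ (hap k) h)
    (fun b ↦ by
      simp only [AddMonoidHom.coe_mulLeft]
      rw [← sum_mul, ← Int.cast_sum, hsum, Int.cast_zero, zero_mul])
    J w
    (fun x ↦ by
      simp only [w]
      rw [← Int.cast_sum, (mem_filter.1 (hJ x.2)).2, Int.cast_zero])
    (fun k ↦ by
      refine le_trans ?_ ((hquad k).trans (by rw [hcardZ]; gcongr))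
      norm_cast
      -- Disjointness makes the `k`-th entry determine the member of `J`, so quadruples of indices
      -- nontrivial as indices stay nontrivial as integers.
      refine card_le_card_of_injOn (fun t l ↦ (t l).1 k) ?_ ?_
      · intro t ht
        obtain ⟨h1, h2⟩ := (mem_filter.1 (mem_coe.1 ht)).2
        refine mem_coe.2 (mem_filter.2 ⟨Fintype.mem_piFinset.2 fun l ↦ hmem _ (t l).2 k, ?_, ?_⟩)
        · have h3 : (((t 0).1 k + (t 1).1 k - ((t 2).1 k + (t 3).1 k) : ℤ) : ZMod p) = 0 := by
            have h4 : (a k : ZMod p) *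
                (((t 0).1 k + (t 1).1 k - ((t 2).1 k + (t 3).1 k) : ℤ) : ZMod p) = 0 := by
              simp only [w] at h1
              push_cast at h1 ⊢
              linear_combination h1
            exact (mul_eq_zero.1 h4).resolve_left (hap k)
          have h5 := int_eq_zero_of_cast_zmod_eq_zero h3 (by
            have b0 := hrange _ (t 0).2 k
            have b1 := hrange _ (t 1).2 k
            have b2 := hrange _ (t 2).2 k
            have b3 := hrange _ (t 3).2 k
            have : (2 * n : ℤ) < p := by
              exact_mod_cast (show 2 * n < p by nlinarith [Nat.zero_le (A * n)])
            rw [abs_lt]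
            constructor <;> linarith)
          linarith
        · have inj : ∀ l l', (t l).1 k = (t l').1 k → t l = t l' := fun l l' h ↦
            Subtype.ext (hdisj _ (t l).2 _ (t l').2 k h)
          exact fun h ↦ h2 (h.imp (fun h ↦ ⟨inj _ _ h.1, inj _ _ h.2⟩)
            fun h ↦ ⟨inj _ _ h.1, inj _ _ h.2⟩)
      · intro t _ t' _ h
        funext l
        exact Subtype.ext (hdisj _ (t l).2 _ (t' l).2 k (congrFun h l)))
    (by
      rw [hcardZ, Fintype.card_coe]
      refine le_trans ?_ hlt.le
      have hK0 : (0 : ℝ) < √(2 * K) := Real.sqrt_pos.2 (by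
        have : 0 < K := by omega
        positivity)
      have h1 : √(p : ℝ) ≤ √(2 * K) * √n := by
        rw [← Real.sqrt_mul (by positivity)]
        refine Real.sqrt_le_sqrt ?_
        exact_mod_cast (show p ≤ 2 * K * n by linarith)
      calc δ / √(2 * K) * √(p : ℝ) ≤ δ / √(2 * K) * (√(2 * K) * √n) := by gcongr
        _ = δ * √n := by field_simp)
  rw [hcardZ] at hmany
  have hcount : #{t : Fin 5 → J | ∑ k, w k (t k) = 0} ≤ #(linSolutions a X) := by
    refine card_le_card_of_injOn (fun t k ↦ (t k).1 k) ?_ ?_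
    · intro t ht
      have h1 := (mem_filter.1 (mem_coe.1 ht)).2
      refine mem_coe.2 (mem_filter.2 ⟨Fintype.mem_piFinset.2 fun k ↦ hmem _ (t k).2 k, ?_⟩)
      simp only [w] at h1
      rw [← Int.cast_sum] at h1
      refine int_eq_zero_of_cast_zmod_eq_zero h1 ?_
      have h2 : |∑ k, a k * (t k).1 k| ≤ A * n := by
        calc _ ≤ ∑ k, |a k * (t k).1 k| := abs_sum_le_sum_abs _ _
          _ ≤ ∑ k, ((a k).natAbs : ℤ) * n := by
            refine sum_le_sum fun k _ ↦ ?_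
            rw [abs_mul, Int.abs_eq_natAbs (a k)]
            have := hrange _ (t k).2 k
            gcongr
            rw [abs_of_nonneg (by linarith)]
            exact this.2
          _ = A * n := by rw [← sum_mul, hA]; push_cast; rfl
      refine h2.trans_lt ?_
      exact_mod_cast (show A * n < p by omega)
    · intro t _ t' _ h
      funext k
      exact Subtype.ext (hdisj _ (t k).2 _ (t' k).2 k (congrFun h k))
  have h1 : c * (n * √n) ≤ c * (p * √(p : ℝ)) := by
    have : (n : ℝ) ≤ p := by exact_mod_cast hnp
    gcongr
  have h2 : (#{t : Fin 5 → J | ∑ k, w k (t k) = 0} : ℝ) ≤ #(linSolutions a X) := by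
    exact_mod_cast hcount
  linarith

lemma rpow_three_halves (n : ℕ) : (n : ℝ) ^ (3 / 2 : ℝ) = n * √n := by
  rcases Nat.eq_zero_or_pos n with rfl | hn
  · simp
  · have : (0 : ℝ) < n := by exact_mod_cast hn
    rw [Real.sqrt_eq_rpow, ← Real.rpow_one_add' this.le (by norm_num)]
    norm_num

/-- The removal theorem. -/
theorem exists_removal (a : Fin 5 → ℤ) (ha : ∀ i, a i ≠ 0) (hsum : ∑ i, a i = 0)
    (X : ℕ → Fin 5 → Finset ℤ) (hX : ∀ n i, X n i ⊆ Icc 1 (n : ℤ))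
    (hquad : ∀ i, (fun n : ℕ => ((nontrivialQuadruples (X n i)).card : ℝ))
      =o[atTop] fun n : ℕ => (n : ℝ))
    (hlin : (fun n : ℕ => ((linSolutions a (X n)).card : ℝ))
      =o[atTop] fun n : ℕ => (n : ℝ) ^ (3 / 2 : ℝ)) :
    ∃ R : ℕ → Fin 5 → Finset ℤ, (∀ n i, R n i ⊆ X n i) ∧
      (∀ i, (fun n : ℕ => ((R n i).card : ℝ)) =o[atTop] fun n : ℕ => √(n : ℝ)) ∧
      ∀ n, linSolutions a (fun i => X n i \ R n i) = ∅ := by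
  choose J hJ hdisj hmax using fun n ↦ exists_maximal_disjoint_family (linSolutions a (X n))
  -- A solution avoiding all these entries could be added to the maximal family.
  refine ⟨fun n i ↦ (J n).image fun x ↦ x i, ?_, ?_, ?_⟩
  · intro n i
    refine image_subset_iff.2 fun x hx ↦ ?_
    exact Fintype.mem_piFinset.1 (mem_filter.1 (hJ n hx)).1 i
  · intro i
    refine isLittleO_iff.2 fun δ hδ ↦ ?_
    obtain ⟨c, hc, n₀, h⟩ := card_disjoint_solutions_le ha hsum hδ
    have hquad' : ∀ᶠ n : ℕ in atTop, ∀ i, (#(nontrivialQuadruples (X n i)) : ℝ) ≤ c * n := by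
      refine eventually_all.2 fun i ↦ ((isLittleO_iff.1 (hquad i)) hc).mono fun n hn ↦ ?_
      simpa using hn
    filter_upwards [hquad', (isLittleO_iff.1 hlin) (half_pos hc), eventually_ge_atTop n₀,
      eventually_ge_atTop 1] with n h1 h2 h3 h4
    have h5 : (0 : ℝ) < n * √n := by
      have : (0 : ℝ) < n := by exact_mod_cast h4
      positivity
    rw [rpow_three_halves, Real.norm_of_nonneg h5.le, Real.norm_natCast] at h2
    have h6 := h n h3 (X n) (hX n) h1 (by nlinarith) (J n) (hJ n) (hdisj n)
    rw [Real.norm_natCast, Real.norm_of_nonneg (Real.sqrt_nonneg _)]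
    exact le_trans (by exact_mod_cast card_image_le) h6
  · intro n
    refine eq_empty_of_forall_notMem fun v hv ↦ ?_
    obtain ⟨hv1, hv2⟩ := mem_filter.1 hv
    have hv3 := fun i ↦ mem_sdiff.1 (Fintype.mem_piFinset.1 hv1 i)
    obtain ⟨x, hx, i, hi⟩ := hmax n v
      (mem_filter.2 ⟨Fintype.mem_piFinset.2 fun i ↦ (hv3 i).1, hv2⟩)
    exact (hv3 i).2 (mem_image.2 ⟨x, hx, hi.symm⟩)

end IntegerRemoval

/-! ### Sets without nontrivial solutions. -/

section Avoiding

open Finset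

variable {a b : ℤ} {X : Finset ℤ}

/-- Setting the third and fifth variables equal cancels `b` and leaves `a` times the Sidon equation.
-/
lemma AvoidsNontrivial.nontrivialQuadruples_eq_empty (hX : AvoidsNontrivial a b X) :
    nontrivialQuadruples X = ∅ := by
  refine eq_empty_of_forall_notMem fun v hv ↦ ?_
  obtain ⟨hv1, hv2, hv3⟩ := mem_filter.1 hv
  have hmem := Fintype.mem_piFinset.1 hv1
  obtain ⟨x, y, h⟩ := hX ![v 0, v 1, v 3, v 2, v 3]
    (by intro i; fin_cases i; exacts [hmem 0, hmem 1, hmem 3, hmem 2, hmem 3])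
    (by
      change a * v 0 + a * v 1 + b * v 3 = a * v 2 + (a + b) * v 3
      linear_combination a * hv2)
  refine hv3 ?_
  rcases h with h | h | ⟨-, h⟩
  · left
    have h0 : v 0 = x := congrFun h 0
    have h1 : v 1 = y := congrFun h 1
    have h3 : v 2 = x := congrFun h 3
    have h4 : v 3 = y := congrFun h 4
    exact ⟨h0.trans h3.symm, h1.trans h4.symm⟩
  · right
    have h0 : v 0 = y := congrFun h 0
    have h1 : v 1 = x := congrFun h 1
    have h3 : v 2 = x := congrFun h 3
    have h4 : v 3 = y := congrFun h 4
    exact ⟨h0.trans h4.symm, h1.trans h3.symm⟩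
  · left
    have h0 : v 0 = y := congrFun h 0
    have h1 : v 1 = y := congrFun h 1
    have h2 : v 3 = x := congrFun h 2
    have h3 : v 2 = x := congrFun h 3
    have h4 : v 3 = y := congrFun h 4
    have hxy : x = y := h2.symm.trans h4
    exact ⟨h0.trans (hxy ▸ h3.symm), h1.trans h4.symm⟩

/-- Differences of distinct elements of a Sidon set are distinct, nonzero and lie in `[-n, n]`. -/
lemma card_sq_le_of_nontrivialQuadruples_eq_empty {n : ℕ} (hn : 1 ≤ n)
    (hX : X ⊆ Icc 1 (n : ℤ)) (h : nontrivialQuadruples X = ∅) : #X ^ 2 ≤ 4 * n := by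
  have h1 : #X ≤ n := by simpa using card_le_card hX
  have h2 : #X.offDiag ≤ #((Icc (-(n : ℤ)) n).erase 0) := by
    refine card_le_card_of_injOn (fun q ↦ q.1 - q.2) ?_ ?_
    · rintro ⟨x, y⟩ hxy
      obtain ⟨hx, hy, hne⟩ := mem_offDiag.1 (mem_coe.1 hxy)
      have b1 := mem_Icc.1 (hX hx)
      have b2 := mem_Icc.1 (hX hy)
      refine mem_coe.2 (mem_erase.2 ⟨sub_ne_zero.2 hne, mem_Icc.2 ?_⟩)
      simp only at b1 b2 ⊢
      omega
    · rintro ⟨x, y⟩ hxy ⟨x', y'⟩ hxy' heq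
      obtain ⟨hx, hy, hne⟩ := mem_offDiag.1 (mem_coe.1 hxy)
      obtain ⟨hx', hy', -⟩ := mem_offDiag.1 (mem_coe.1 hxy')
      simp only at heq hx hy hx' hy' hne
      by_contra hcon
      refine notMem_empty ![x, y', x', y] (h ▸ mem_filter.2 ⟨Fintype.mem_piFinset.2 ?_, ?_, ?_⟩)
      · intro i
        fin_cases i
        exacts [hx, hy', hx', hy]
      · change x + y' = x' + y
        linarith
      · rintro (⟨h0, h1⟩ | ⟨h0, -⟩)
        · change x = x' at h0
          change y' = y at h1
          exact hcon (by rw [h0, h1])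
        · exact hne h0
  rw [offDiag_card, card_erase_of_mem (mem_Icc.2 (by omega)), Int.card_Icc] at h2
  rw [sq]
  omega

lemma AvoidsNontrivial.card_linSolutions_le (hX : AvoidsNontrivial a b X) :
    #(linSolutions ![a, a, b, -a, -(a + b)] fun _ ↦ X) ≤ 3 * #X ^ 2 := by
  have hsub : linSolutions ![a, a, b, -a, -(a + b)] (fun _ ↦ X) ⊆
      (X ×ˢ X).image (fun q ↦ ![q.1, q.2, q.2, q.1, q.2]) ∪
      (X ×ˢ X).image (fun q ↦ ![q.2, q.1, q.2, q.1, q.2]) ∪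
      (X ×ˢ X).image (fun q ↦ ![q.2, q.2, q.1, q.1, q.2]) := by
    intro v hv
    obtain ⟨hv1, hv2⟩ := mem_filter.1 hv
    have hmem := Fintype.mem_piFinset.1 hv1
    rw [Fin.sum_univ_five] at hv2
    change a * v 0 + a * v 1 + b * v 2 + -a * v 3 + -(a + b) * v 4 = 0 at hv2
    obtain ⟨x, y, h⟩ := hX v hmem (by linear_combination hv2)
    have hxy : x ∈ X ∧ y ∈ X := by
      rcases h with rfl | rfl | ⟨-, rfl⟩ <;> exact ⟨hmem 3, hmem 4⟩
    have hq : (x, y) ∈ X ×ˢ X := mem_product.2 hxy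
    rcases h with rfl | rfl | ⟨-, rfl⟩
    · exact mem_union_left _ (mem_union_left _ (mem_image_of_mem _ hq))
    · exact mem_union_left _ (mem_union_right _ (mem_image_of_mem _ hq))
    · exact mem_union_right _ (mem_image_of_mem _ hq)
  have hcard : #(X ×ˢ X) = #X ^ 2 := by rw [card_product, sq]
  refine (card_le_card hsub).trans ((card_union_le _ _).trans ?_)
  refine (Nat.add_le_add ((card_union_le _ _).trans (Nat.add_le_add card_image_le card_image_le))
    card_image_le).trans ?_
  omega

theorem AvoidsNontrivial.card_isLittleO (ha : 0 < a) (hb : 0 < b) (X : ℕ → Finset ℤ)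
    (hX : ∀ n, X n ⊆ Icc 1 (n : ℤ)) (hav : ∀ n, AvoidsNontrivial a b (X n)) :
    (fun n : ℕ ↦ (#(X n) : ℝ)) =o[atTop] fun n : ℕ ↦ √(n : ℝ) := by
  have hsum : ∑ i, (![a, a, b, -a, -(a + b)] : Fin 5 → ℤ) i = 0 := by
    rw [Fin.sum_univ_five]
    change a + a + b + -a + -(a + b) = 0
    ring
  obtain ⟨R, -, hR, hfree⟩ := exists_removal ![a, a, b, -a, -(a + b)]
    (by
      intro i
      fin_cases i
      exacts [ha.ne', ha.ne', hb.ne', neg_ne_zero.2 ha.ne', neg_ne_zero.2 (by omega)])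
    hsum (fun n _ ↦ X n) (fun n _ ↦ hX n)
    (fun _ ↦ by
      simp only [(hav _).nontrivialQuadruples_eq_empty, card_empty, Nat.cast_zero]
      exact isLittleO_zero _ _)
    (by
      have hO : (fun n : ℕ ↦ (#(linSolutions ![a, a, b, -a, -(a + b)] fun _ ↦ X n) : ℝ))
          =O[atTop] fun n : ℕ ↦ (n : ℝ) * 1 := by
        refine IsBigO.of_bound 12 ((eventually_ge_atTop 1).mono fun n hn ↦ ?_)
        have h1 := card_sq_le_of_nontrivialQuadruples_eq_empty hn (hX n)
          ((hav n).nontrivialQuadruples_eq_empty)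
        have h2 := (hav n).card_linSolutions_le
        rw [mul_one, Real.norm_natCast, Real.norm_natCast]
        exact_mod_cast (show _ ≤ 12 * n by linarith)
      simp_rw [rpow_three_halves]
      refine hO.trans_isLittleO ((isBigO_refl _ _).mul_isLittleO
        ((isLittleO_one_left_iff ℝ).2 ?_))
      exact tendsto_norm_atTop_atTop.comp
        (Real.tendsto_sqrt_atTop.comp tendsto_natCast_atTop_atTop))
  refine IsBigO.trans_isLittleO (IsBigO.of_bound 1 (Eventually.of_forall fun n ↦ ?_))
    (IsLittleO.sum fun i (_ : i ∈ (univ : Finset (Fin 5))) ↦ hR i)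
  -- An element outside every `R n i` would give a surviving constant solution, as the coefficients
  -- sum to zero.
  have hcover : X n ⊆ univ.biUnion fun i ↦ R n i := by
    intro x hx
    by_contra hcon
    refine notMem_empty (fun _ : Fin 5 ↦ x) (hfree n ▸ mem_filter.2 ⟨Fintype.mem_piFinset.2 fun i ↦ ?_, ?_⟩)
    · exact mem_sdiff.2 ⟨hx, fun h ↦ hcon (mem_biUnion.2 ⟨i, mem_univ _, h⟩)⟩
    · rw [← sum_mul, hsum, zero_mul]
  have h1 : (#(X n) : ℝ) ≤ ∑ i, (#(R n i) : ℝ) := by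
    exact_mod_cast (card_le_card hcover).trans card_biUnion_le
  rw [one_mul, Real.norm_natCast]
  exact h1.trans (le_abs_self _)

end Avoiding

theorem mainTheorem6 :
    -- the removal theorem
    (∀ a : Fin 5 → ℤ, (∀ i, a i ≠ 0) → ∑ i, a i = 0 →
      ∀ X : ℕ → Fin 5 → Finset ℤ, (∀ n i, X n i ⊆ Finset.Icc 1 (n : ℤ)) →
        (∀ i, (fun n : ℕ => ((nontrivialQuadruples (X n i)).card : ℝ))
          =o[atTop] fun n : ℕ => (n : ℝ)) →
        ((fun n : ℕ => ((linSolutions a (X n)).card : ℝ))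
          =o[atTop] fun n : ℕ => (n : ℝ) ^ (3 / 2 : ℝ)) →
        ∃ R : ℕ → Fin 5 → Finset ℤ,
          (∀ n i, R n i ⊆ X n i) ∧
          (∀ i, (fun n : ℕ => ((R n i).card : ℝ)) =o[atTop] fun n : ℕ => √(n : ℝ)) ∧
          ∀ n, linSolutions a (fun i => X n i \ R n i) = ∅) ∧
    -- the consequence for sets without nontrivial solutions
    (∀ a b : ℤ, 0 < a → 0 < b →
      ∃ f : ℕ → ℝ, (f =o[atTop] fun n : ℕ => √(n : ℝ)) ∧
        ∀ (n : ℕ) (X : Finset ℤ), X ⊆ Finset.Icc 1 (n : ℤ) → AvoidsNontrivial a b X →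
          (X.card : ℝ) ≤ f n) := by
  refine ⟨exists_removal, fun a b ha hb ↦ ?_⟩
  classical
  -- A uniform bound `f` comes from applying the asymptotic statement to a largest admissible set
  -- for each `n`.
  let F : ℕ → Finset (Finset ℤ) := fun n ↦
    (Finset.Icc 1 (n : ℤ)).powerset.filter fun X ↦ AvoidsNontrivial a b X
  have hne : ∀ n, (F n).Nonempty := fun n ↦
    ⟨∅, Finset.mem_filter.2 ⟨Finset.empty_mem_powerset _, fun v hv ↦ by simpa using hv 0⟩⟩
  choose X hX hmax using fun n ↦ Finset.exists_max_image (F n) Finset.card (hne n)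
  refine ⟨fun n ↦ ((X n).card : ℝ), AvoidsNontrivial.card_isLittleO ha hb X
    (fun n ↦ Finset.mem_powerset.1 (Finset.mem_filter.1 (hX n)).1)
    (fun n ↦ (Finset.mem_filter.1 (hX n)).2), fun n Y hY hav ↦ ?_⟩
  exact Nat.cast_le.2 (hmax n Y (Finset.mem_filter.2 ⟨Finset.mem_powerset.2 hY, hav⟩))
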